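/- Let $B_1=\{(x,y)\in\mathbb R^2: x^2+y^2<1\}$ and, for $\beta\ge 0$, let $A_\beta(x,y)=\frac{\beta}{2}(-y,x)$ and $\nabla^{A_\beta}u=\nabla u-i\,u\,A_\beta$. A real number $\lambda$ is called a magnetic Neumann eigenvalue of $B_1$ with field $\beta$ if there is $u\in H^1(B_1;\mathbb C)$, $u\neq0$, such that $$\int_{B_1}\nabla^{A_\beta}u\cdot\overline{\nabla^{A_\beta}v}\,dp=\lambda\int_{B_1}u\,\overline v\,dp\qquad\text{for all }v\in H^1(B_1;\mathbb C),$$ i.e. if $\lambda$ is an eigenvalue of the Neumann realization of the magnetic Laplacian with potential $A_\beta$. Let $\lambda_1^N(B_1,\beta)$ be the smallest such eigenvalue. Let $\kappa_1(0,\beta,1)$ be the smallest real $\kappa$ for which the Sturm–Liouville problem $$-v''-\frac1r v'+\Big(\frac{\beta r}{2}\Big)^2v=\kappa v\ \text{ in }]0,1[,\qquad \lim_{r\to0}r\,v'(r)=0,\qquad v'(1)=0$$ has a solution $v$ that is not identically zero. **Proposition.** For every $\beta\ge0$ both smallest eigenvalues exist. For all $\beta\in[0,1]$, $$\lambda_1^N(B_1,\beta)=\kappa_1(0,\beta,1).$$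 Moreover, there is a largest number $\beta^*>0$ such that $\lambda_1^N(B_1,\beta)=\kappa_1(0,\beta,1)$ for all $\beta\in[0,\beta^*]$, and $\beta^*\ge1$. -/

import Mathlib

open MeasureTheory Set Filter Topology
open scoped ContDiff ComplexConjugate

namespace MagneticDisk

/-- The open disk of radius `R` centered at the origin of the plane. The plane is `ℝ × ℝ` with its
Lebesgue measure; the Euclidean disk is written out because the norm of `ℝ × ℝ` is the sup norm. -/
def disk (R : ℝ) : Set (ℝ × ℝ) := {p | 0 < R ∧ p.1 ^ 2 + p.2 ^ 2 < R ^ 2}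

/-- A smooth real-valued test function with compact support inside `Ω`. -/
structure IsTestFunction (Ω : Set (ℝ × ℝ)) (φ : ℝ × ℝ → ℝ) : Prop where
  smooth : ContDiff ℝ ∞ φ
  compact : HasCompactSupport φ
  support_subset : tsupport φ ⊆ Ω

/-- `u` belongs to the complex Sobolev space `H¹(Ω)`, with weak partial derivatives `ux`, `uy`:
all three are in `L²(Ω)`, and the derivatives are taken in the sense of distributions. -/
structure IsSobolevH1 (Ω : Set (ℝ × ℝ)) (u ux uy : ℝ × ℝ → ℂ) : Prop where
  memLp : MemLp u 2 (volume.restrict Ω)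
  memLp_x : MemLp ux 2 (volume.restrict Ω)
  memLp_y : MemLp uy 2 (volume.restrict Ω)
  weak_x : ∀ φ : ℝ × ℝ → ℝ, IsTestFunction Ω φ →
    ∫ p in Ω, u p * ((fderiv ℝ φ p (1, 0) : ℝ) : ℂ) = -∫ p in Ω, ux p * ((φ p : ℝ) : ℂ)
  weak_y : ∀ φ : ℝ × ℝ → ℝ, IsTestFunction Ω φ →
    ∫ p in Ω, u p * ((fderiv ℝ φ p (0, 1) : ℝ) : ℂ) = -∫ p in Ω, uy p * ((φ p : ℝ) : ℂ)

/-- The standard vector potential `A_S(x, y) = (-y, x) / 2`, with magnetic field `1`. -/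
noncomputable def standardPotential (p : ℝ × ℝ) : ℝ × ℝ := (-p.2 / 2, p.1 / 2)

/-- The sesquilinear form `b(u, v) = ∫_Ω ∇ᴬu · conj (∇ᴬv)` of the magnetic Laplacian, where
`∇ᴬu = ∇u - i u A`. The weak gradients of `u` and `v` are passed as arguments. -/
noncomputable def magneticForm (Ω : Set (ℝ × ℝ)) (A : ℝ × ℝ → ℝ × ℝ)
    (u ux uy v vx vy : ℝ × ℝ → ℂ) : ℂ :=
  ∫ p in Ω,
    ((ux p - Complex.I * u p * ((A p).1 : ℂ)) * conj (vx p - Complex.I * v p * ((A p).1 : ℂ)) +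
      (uy p - Complex.I * u p * ((A p).2 : ℂ)) * conj (vy p - Complex.I * v p * ((A p).2 : ℂ)))

/-- `lam` is an eigenvalue of the Neumann realization of the magnetic Laplacian on the bounded open
set `Ω`, that is, of the self-adjoint operator `T` in `L²(Ω)` associated with the form `b` with form
domain `H¹(Ω)`. The equation `T u = lam u` means that `u ∈ H¹(Ω)` and
`b(u, v) = lam ⟨u, v⟩` for all `v ∈ H¹(Ω)`. (Eigenvalues are real, since `T` is self-adjoint.) -/
def IsNeumannEigenvalue (Ω : Set (ℝ × ℝ)) (A : ℝ × ℝ → ℝ × ℝ) (lam : ℝ) : Prop :=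
  ∃ u ux uy : ℝ × ℝ → ℂ, IsSobolevH1 Ω u ux uy ∧ ¬ (u =ᵐ[volume.restrict Ω] 0) ∧
    ∀ v vx vy : ℝ × ℝ → ℂ, IsSobolevH1 Ω v vx vy →
      magneticForm Ω A u ux uy v vx vy = (lam : ℂ) * ∫ p in Ω, u p * conj (v p)

/-- The set of eigenvalues of the magnetic Neumann Laplacian on `Ω` with uniform magnetic field
`β`, realized by the vector potential `β A_S`. -/
def neumannEigenvalues (Ω : Set (ℝ × ℝ)) (β : ℝ) : Set ℝ :=
  {lam | IsNeumannEigenvalue Ω (fun p => β • standardPotential p) lam}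

/-- The first eigenvalue `λ₁ᴺ(Ω, β)`. -/
noncomputable def lambdaOne (Ω : Set (ℝ × ℝ)) (β : ℝ) : ℝ := sInf (neumannEigenvalues Ω β)

/-- `κ` is an eigenvalue of the Sturm–Liouville problem
`-v'' - v' / r + (β r / 2 - n / r)² v = κ v` in `]0, R[`, `r v'(r) → 0` as `r → 0`, `v'(R) = 0`.
As the equation is regular at `R`, the last condition is equivalently read as a limit from the
left; as `κ` and the coefficients are real, real-valued eigenfunctions suffice. -/
def IsSturmLiouvilleEigenvalue (n : ℤ) (β R κ : ℝ) : Prop :=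
  ∃ v : ℝ → ℝ, (∃ r ∈ Ioo 0 R, v r ≠ 0) ∧ ContDiffOn ℝ 2 v (Ioo 0 R) ∧
    (∀ r ∈ Ioo 0 R,
      -deriv (deriv v) r - 1 / r * deriv v r + (β * r / 2 - (n : ℝ) / r) ^ 2 * v r = κ * v r) ∧
    Tendsto (fun r => r * deriv v r) (𝓝[>] 0) (𝓝 0) ∧
    Tendsto (deriv v) (𝓝[<] R) (𝓝 0)

/-- The set of eigenvalues of the Sturm–Liouville problem with parameters `n`, `β`, `R`. -/
def sturmLiouvilleEigenvalues (n : ℤ) (β R : ℝ) : Set ℝ :=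
  {κ | IsSturmLiouvilleEigenvalue n β R κ}

/-- The first eigenvalue `κ₁(n, β, R)`. -/
noncomputable def kappaOne (n : ℤ) (β R : ℝ) : ℝ := sInf (sturmLiouvilleEigenvalues n β R)

/-- The positive numbers `β₀` such that `λ₁ᴺ(B₁, β) = κ₁(0, β, 1)` for all `β ∈ [0, β₀]`. -/
def radialThresholds : Set ℝ :=
  {β₀ | 0 < β₀ ∧ ∀ β ∈ Icc 0 β₀, lambdaOne (disk 1) β = kappaOne 0 β 1}

/-- The threshold `β*`, meant as the largest element of `radialThresholds`. -/
noncomputable def betaStar : ℝ := sSup radialThresholds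

end MagneticDisk

/-!
The gauge is rotation invariant, so the magnetic Laplacian separates in polar coordinates. On
functions `u = (x ± i y) ^ m F(x² + y²)`, with `t = x² + y²`, the equation `H u = λ u` becomes `4 t
F'' + 4 (m + 1) F' = (β² t / 4 + b) F` with `b = ∓ β m - λ`, whose solution regular at the origin is
an entire power series (`reg`), and the Neumann condition becomes `m F 1 + 2 F' 1 = 0` (`flux`).

*The Neumann spectrum is the set of zeros of the fluxes.* A zero gives a smooth Neumann
eigenfunction, which satisfies the weak equation by Green's formula
(`magneticForm_eq_integral_magLap`); since the normal derivative vanishes to first order at the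
circle, that formula follows from the definition of weak derivatives by cutoff functions, without
traces. Conversely, if no flux vanishes at `λ`, then `(H - λ) g = z ^ a z̄ ^ b` has a smooth Neumann
solution `g` for all `a` and `b`, so an eigenfunction would be orthogonal to all polynomials in `z`
and `z̄`, and hence zero (`exists_flux_eq_zero`).

*Ground states.* For each `m` there is a largest zero `b = topRoot m (β² / 4)` of the flux, with a
positive solution (`exists_ground`); the lowest energies are therefore `∓ β m - topRoot m (β² / 4)`.
For the Sturm–Liouville problem, Picone's identity with the positive solution for `m = 0` shows that
`-topRoot 0 (β² / 4)` is the least eigenvalue (`isLeast_sturmLiouvilleEigenvalues`).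

*Comparison of modes.* Wronskians of positive solutions show that the centrifugal term raises the
energy by at least `m²` (`topRoot_add_sq_lt`). So the energy of the mode `m > 0` exceeds that of the
mode `0` by more than `m² - β m`, which is nonnegative for `β ≤ m`. Hence the mode `0` wins for `β ≤
1`, and for every `β` only finitely many modes compete. The same comparison makes the energies
continuous in `β` (`topRoot_le_add`), so that the set of thresholds is closed at its supremum. It is
bounded, because at `β = 6` a ladder operator turns the ground state of the mode `0` into a positive
solution for the mode `1` with negative flux (`topRoot_zero_sub_lt_topRoot_one`).
-/

namespace MagneticDisk

/-! ### Entire power series -/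

/-- The coefficients `c` decay like those of an exponential, `|c k| ≤ C M ^ k / k!`, so that
`∑ c k t ^ k` converges on the whole line. -/
def EntireBound (c : ℕ → ℝ) (C M : ℝ) : Prop := ∀ k, |c k| ≤ C * (M ^ k / k.factorial)

/-- The sum of the power series with coefficients `c`. -/
noncomputable def ser (c : ℕ → ℝ) (t : ℝ) : ℝ := ∑' k, c k * t ^ k

/-- The coefficients of the termwise derivative. -/
def dcoef (c : ℕ → ℝ) (k : ℕ) : ℝ := (k + 1) * c (k + 1)

theorem EntireBound.dcoef {c : ℕ → ℝ} {C M : ℝ} (h : EntireBound c C M) :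
    EntireBound (dcoef c) (C * M) M := by
  intro k
  have h1 := h (k + 1)
  have hk : (0 : ℝ) < k + 1 := by positivity
  rw [MagneticDisk.dcoef, abs_mul, abs_of_pos hk]
  calc ((k : ℝ) + 1) * |c (k + 1)|
      ≤ (k + 1) * (C * (M ^ (k + 1) / (k + 1).factorial)) := by gcongr
    _ = C * M * (M ^ k / k.factorial) := by
      rw [Nat.factorial_succ]; push_cast; field_simp; ring

theorem EntireBound.abs_term_le {c : ℕ → ℝ} {C M T t : ℝ} (h : EntireBound c C M) (ht : |t| ≤ T)
    (k : ℕ) : |c k * t ^ k| ≤ C * ((M * T) ^ k / k.factorial) := by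
  rw [abs_mul, abs_pow]
  calc |c k| * |t| ^ k ≤ (C * (M ^ k / k.factorial)) * T ^ k := by
        gcongr
        · exact (abs_nonneg _).trans (h k)
        · exact h k
    _ = C * ((M * T) ^ k / k.factorial) := by rw [mul_pow]; ring

theorem EntireBound.summable {c : ℕ → ℝ} {C M : ℝ} (h : EntireBound c C M) (t : ℝ) :
    Summable fun k => c k * t ^ k :=
  Summable.of_norm_bounded ((Real.summable_pow_div_factorial (M * |t|)).mul_left C)
    fun k => h.abs_term_le le_rfl k

theorem EntireBound.hasDerivAt_ser {c : ℕ → ℝ} {C M : ℝ} (h : EntireBound c C M) (t : ℝ) :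
    HasDerivAt (ser c) (ser (MagneticDisk.dcoef c) t) t := by
  set T := |t| + 1
  have hb : ∀ k : ℕ, ∀ y ∈ Ioo (-T) T, ‖(k : ℝ) * c k * y ^ (k - 1)‖ ≤
      (Nat.casesOn k 0 fun j => C * M * ((M * T) ^ j / j.factorial) : ℝ) := by
    intro k y hy
    cases k with
    | zero => simp
    | succ j =>
      have := h.dcoef.abs_term_le (abs_lt.2 hy).le j
      simpa [MagneticDisk.dcoef, Real.norm_eq_abs] using this
  have hs : Summable (fun k : ℕ => (Nat.casesOn k 0 fun j => C * M * ((M * T) ^ j / j.factorial) : ℝ)) := by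
    rw [← summable_nat_add_iff 1]
    exact (Real.summable_pow_div_factorial (M * T)).mul_left (C * M)
  have ht : t ∈ Ioo (-T) T := abs_lt.1 (by simp [T])
  have key := hasDerivAt_tsum_of_isPreconnected (g := fun k y => c k * y ^ k)
    (g' := fun k y => (k : ℝ) * c k * y ^ (k - 1)) hs isOpen_Ioo isPreconnected_Ioo
    (fun k y _ => by
      have := (hasDerivAt_pow k y).const_mul (c k)
      exact this.congr_deriv (by ring)) hb ht (h.summable t) ht
  have hs' : Summable fun k : ℕ => (k : ℝ) * c k * t ^ (k - 1) :=
    Summable.of_norm_bounded hs fun k => hb k t ht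
  have e : ∑' k : ℕ, (k : ℝ) * c k * t ^ (k - 1) = ser (MagneticDisk.dcoef c) t := by
    rw [hs'.tsum_eq_zero_add]
    simp [ser, MagneticDisk.dcoef]
  rw [← e]
  exact key

theorem EntireBound.deriv_ser {c : ℕ → ℝ} {C M : ℝ} (h : EntireBound c C M) :
    deriv (ser c) = ser (MagneticDisk.dcoef c) := funext fun t => (h.hasDerivAt_ser t).deriv

theorem EntireBound.contDiff_ser {c : ℕ → ℝ} {C M : ℝ} (h : EntireBound c C M) :
    ContDiff ℝ ∞ (ser c) := by
  rw [contDiff_infty]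
  intro n
  induction n generalizing c C with
  | zero =>
    have : Continuous (ser c) :=
      continuous_iff_continuousAt.2 fun t => (h.hasDerivAt_ser t).continuousAt
    exact contDiff_zero.2 this
  | succ n ih =>
    push_cast
    rw [contDiff_succ_iff_deriv]
    refine ⟨fun t => (h.hasDerivAt_ser t).differentiableAt, by simp, ?_⟩
    rw [h.deriv_ser]
    exact ih h.dcoef

theorem ser_zero (c : ℕ → ℝ) : ser c 0 = c 0 := by
  rw [ser, tsum_eq_single 0 fun k hk => by simp [hk]]
  simp

theorem ser_pi_single (j : ℕ) (t : ℝ) : ser (Pi.single j 1) t = t ^ j := by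
  rw [ser, tsum_eq_single j fun k hk => by simp [hk]]
  simp

theorem EntireBound.mul_ser {c : ℕ → ℝ} {C M : ℝ} (h : EntireBound c C M) (t : ℝ) :
    HasSum (fun k : ℕ => (Nat.casesOn k 0 c : ℝ) * t ^ k) (t * ser c t) := by
  rw [← hasSum_nat_add_iff' 1]
  have h1 := (h.summable t).hasSum.mul_left t
  have h2 : (fun k => t * (c k * t ^ k)) = fun k => c k * t ^ (k + 1) := by funext k; ring
  rw [h2] at h1
  simpa [ser] using h1

/-- Joint continuity of a power series in its argument and in a parameter. -/
theorem continuous_ser_param {c : ℝ → ℕ → ℝ} (hc : ∀ k, Continuous fun b => c b k)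
    (hb : ∀ A : ℝ, ∃ C M, ∀ b, |b| ≤ A → EntireBound (c b) C M) :
    Continuous fun p : ℝ × ℝ => ser (c p.1) p.2 := by
  rw [continuous_iff_continuousAt]
  intro p
  obtain ⟨C, M, h⟩ := hb (|p.1| + 1)
  have hcont : ContinuousOn (fun p : ℝ × ℝ => ser (c p.1) p.2)
      {q | |q.1| < |p.1| + 1 ∧ |q.2| < |p.2| + 1} := by
    refine continuousOn_tsum (f := fun k (q : ℝ × ℝ) => c q.1 k * q.2 ^ k)
      (u := fun k => C * ((M * (|p.2| + 1)) ^ k / k.factorial)) (fun k => ?_) ((Real.summable_pow_div_factorial _).mul_left C) fun k q hq => ?_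
    · exact (((hc k).comp continuous_fst).mul (continuous_snd.pow k)).continuousOn
    · exact (h q.1 hq.1.le).abs_term_le hq.2.le k
  refine hcont.continuousAt (IsOpen.mem_nhds ?_ (by simp))
  have h1 : Continuous fun q : ℝ × ℝ => |q.1| := by fun_prop
  have h2 : Continuous fun q : ℝ × ℝ => |q.2| := by fun_prop
  exact (isOpen_lt h1 continuous_const).inter (isOpen_lt h2 continuous_const)

/-! ### The radial equation -/

/-- The operator `4 t F'' + 4 (m + 1) F'`. If `u = (x ± i y) ^ m F(x² + y²)`, then
`Δ u = (x ± i y) ^ m (radialOp m F) (x² + y²)`. -/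
noncomputable def radialOp (m : ℕ) (F : ℝ → ℝ) (t : ℝ) : ℝ :=
  4 * t * deriv (deriv F) t + 4 * (m + 1) * deriv F t

/-- The normal derivative at the unit circle of `(x ± i y) ^ m F(x² + y²)`, up to the factor
`(x ± i y) ^ m`. -/
noncomputable def flux (m : ℕ) (F : ℝ → ℝ) : ℝ := m * F 1 + 2 * deriv F 1

/-- The coefficients of the power series solution of `radialOp m F = (a t + b) F - S` with
`F 0 = c₀`, where `S` is the power series with coefficients `e`. -/
noncomputable def solCoeff (m : ℕ) (a b c₀ : ℝ) (e : ℕ → ℝ) : ℕ → ℝ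
  | 0 => c₀
  | 1 => (b * c₀ - e 0) / (4 * (m + 1))
  | k + 2 => (a * solCoeff m a b c₀ e k + b * solCoeff m a b c₀ e (k + 1) - e (k + 1)) /
      (4 * (k + 2) * (k + 2 + m))

theorem entireBound_solCoeff {m : ℕ} {a b c₀ A C : ℝ} {e : ℕ → ℝ} (ha : |a| ≤ A) (hb : |b| ≤ A)
    (hc : |c₀| ≤ C) (he : EntireBound e C (A + 1)) :
    EntireBound (solCoeff m a b c₀ e) C (A + 1) := by
  have hA : 0 ≤ A := (abs_nonneg a).trans ha
  have hC : 0 ≤ C := (abs_nonneg c₀).trans hc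
  have hm : (0 : ℝ) ≤ m := m.cast_nonneg
  intro k
  induction k using Nat.strong_induction_on with
  | _ k ih =>
    match k with
    | 0 => simpa [solCoeff] using hc
    | 1 =>
      have h0 : |e 0| ≤ C := by simpa using he 0
      have h4 : (0 : ℝ) < 4 * (m + 1) := by positivity
      rw [solCoeff, abs_div, abs_of_pos h4, div_le_iff₀ h4]
      calc |b * c₀ - e 0| ≤ |b * c₀| + |e 0| := abs_sub _ _
        _ ≤ A * C + C := by rw [abs_mul]; gcongr
        _ ≤ (A * C + C) * (4 * (m + 1)) := by
          nlinarith [mul_nonneg hA hC, mul_nonneg hC hm, mul_nonneg (mul_nonneg hA hC) hm]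
        _ = _ := by rw [pow_one, Nat.factorial_one]; push_cast; ring
    | k + 2 =>
      have h4 : (0 : ℝ) < 4 * (k + 2) * (k + 2 + m) := by positivity
      have i0 := ih k (by omega)
      have i1 := ih (k + 1) (by omega)
      have i2 := he (k + 1)
      rw [solCoeff, abs_div, abs_of_pos h4, div_le_iff₀ h4]
      set X : ℝ := C * ((A + 1) ^ k / k.factorial) with hX
      have hX0 : 0 ≤ X := by positivity
      have e1 : C * ((A + 1) ^ (k + 1) / (k + 1).factorial) = X * ((A + 1) / (k + 1)) := by
        rw [hX, Nat.factorial_succ]; push_cast; field_simp; ring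
      have e2 : C * ((A + 1) ^ (k + 2) / (k + 2).factorial) =
          X * ((A + 1) ^ 2 / ((k + 1) * (k + 2))) := by
        rw [hX, Nat.factorial_succ, Nat.factorial_succ]; push_cast; field_simp; ring
      rw [e1] at i1 i2
      rw [e2]
      calc |a * solCoeff m a b c₀ e k + b * solCoeff m a b c₀ e (k + 1) - e (k + 1)|
          ≤ |a * solCoeff m a b c₀ e k| + |b * solCoeff m a b c₀ e (k + 1)| + |e (k + 1)| :=
            (abs_sub _ _).trans (by gcongr; exact abs_add_le _ _)
        _ ≤ A * X + A * (X * ((A + 1) / (k + 1))) + X * ((A + 1) / (k + 1)) := by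
            rw [abs_mul, abs_mul]; gcongr
        _ = X * ((A * (k + 1) + (A + 1) ^ 2) / (k + 1)) := by field_simp; ring
        _ ≤ X * ((A + 1) ^ 2 * (4 * (k + 2 + m)) / (k + 1)) := by
            gcongr
            have : (0 : ℝ) ≤ k := k.cast_nonneg
            nlinarith [mul_nonneg hA this, mul_nonneg hA hm, mul_nonneg (sq_nonneg (A + 1)) hm,
              mul_nonneg (sq_nonneg (A + 1)) this, mul_nonneg (sq_nonneg A) this]
        _ = _ := by field_simp

theorem entireBound_zero {C M : ℝ} (hC : 0 ≤ C) (hM : 0 ≤ M) : EntireBound 0 C M := by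
  intro k; simp; positivity

theorem entireBound_pi_single (j : ℕ) {C M : ℝ} (hC : (j.factorial : ℝ) ≤ C) (hM : 1 ≤ M) :
    EntireBound (Pi.single j 1) C M := by
  have hC0 : 0 ≤ C := le_trans (by positivity) hC
  intro k
  by_cases hk : k = j
  · subst hk
    simp only [Pi.single_eq_same, abs_one]
    have h1 : (1 : ℝ) ≤ M ^ k := one_le_pow₀ hM
    have : (0 : ℝ) < k.factorial := by positivity
    rw [mul_div_assoc', le_div_iff₀ this]
    nlinarith
  · simp [hk]; positivity

theorem radialOp_ser_solCoeff {m : ℕ} {a b c₀ C M C' M' : ℝ} {e : ℕ → ℝ} (he : EntireBound e C' M')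
    (h : EntireBound (solCoeff m a b c₀ e) C M) (t : ℝ) :
    radialOp m (ser (solCoeff m a b c₀ e)) t =
      (a * t + b) * ser (solCoeff m a b c₀ e) t - ser e t := by
  set c := solCoeff m a b c₀ e with hc
  have s1 := (h.dcoef.dcoef.mul_ser t).mul_left 4
  have s2 := (h.dcoef.summable t).hasSum.mul_left (4 * ((m : ℝ) + 1))
  have s3 := (h.mul_ser t).mul_left a
  have s4 := (h.summable t).hasSum.mul_left b
  have s5 := (he.summable t).hasSum
  have L := s1.add s2
  have R := (s3.add s4).sub s5
  have hLR : (fun k : ℕ => 4 * ((Nat.casesOn k 0 (dcoef (dcoef c)) : ℝ) * t ^ k) +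
      4 * ((m : ℝ) + 1) * (dcoef c k * t ^ k)) = fun k =>
      a * ((Nat.casesOn k 0 c : ℝ) * t ^ k) + b * (c k * t ^ k) - e k * t ^ k := by
    funext k
    cases k with
    | zero =>
      have h1 : c 1 = (b * c₀ - e 0) / (4 * (m + 1)) := by rw [hc, solCoeff]
      have h0 : c 0 = c₀ := by rw [hc, solCoeff]
      simp [dcoef, h1, h0]
      field_simp
    | succ k =>
      have h1 : c (k + 2) = (a * c k + b * c (k + 1) - e (k + 1)) /
        (4 * (k + 2) * (k + 2 + m)) := by rw [hc, solCoeff]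
      simp only [dcoef, h1]
      push_cast
      have : (k : ℝ) + 2 + m ≠ 0 := by positivity
      have e1 : (k : ℝ) + 1 + 1 = k + 2 := by ring
      rw [e1]
      field_simp
      ring
  rw [hLR] at L
  have := L.unique R
  rw [radialOp, h.deriv_ser, h.dcoef.deriv_ser]
  simp only [ser] at this ⊢
  linarith

/-- The solution of `radialOp m F = (a t + b) F` regular at the origin, normalized by `F 0 = 1`. -/
noncomputable def reg (m : ℕ) (a b : ℝ) : ℝ → ℝ := ser (solCoeff m a b 1 0)

/-- A particular solution of `radialOp m F = (a t + b) F - t ^ j`, regular at the origin. -/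
noncomputable def regPart (m : ℕ) (a b : ℝ) (j : ℕ) : ℝ → ℝ :=
  ser (solCoeff m a b 0 (Pi.single j 1))

theorem entireBound_reg {m : ℕ} {a b A : ℝ} (ha : |a| ≤ A) (hb : |b| ≤ A) :
    EntireBound (solCoeff m a b 1 0) 1 (A + 1) :=
  entireBound_solCoeff ha hb (by simp)
    (entireBound_zero zero_le_one (by linarith [(abs_nonneg a).trans ha]))

theorem entireBound_reg' (m : ℕ) (a b : ℝ) :
    EntireBound (solCoeff m a b 1 0) 1 (max |a| |b| + 1) :=
  entireBound_reg (le_max_left _ _) (le_max_right _ _)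

theorem entireBound_regPart (m : ℕ) (a b : ℝ) (j : ℕ) :
    EntireBound (solCoeff m a b 0 (Pi.single j 1)) j.factorial (max |a| |b| + 1) :=
  entireBound_solCoeff (le_max_left _ _) (le_max_right _ _) (by simp)
    (entireBound_pi_single j le_rfl (by simp))

theorem contDiff_reg (m : ℕ) (a b : ℝ) : ContDiff ℝ ∞ (reg m a b) :=
  (entireBound_reg' m a b).contDiff_ser

theorem contDiff_regPart (m : ℕ) (a b : ℝ) (j : ℕ) : ContDiff ℝ ∞ (regPart m a b j) :=
  (entireBound_regPart m a b j).contDiff_ser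

theorem reg_zero (m : ℕ) (a b : ℝ) : reg m a b 0 = 1 := by rw [reg, ser_zero, solCoeff]

theorem radialOp_reg (m : ℕ) (a b t : ℝ) :
    radialOp m (reg m a b) t = (a * t + b) * reg m a b t := by
  have := radialOp_ser_solCoeff (entireBound_zero zero_le_one zero_le_one)
    (entireBound_reg' m a b) t
  simpa [reg, ser] using this

theorem radialOp_regPart (m : ℕ) (a b : ℝ) (j : ℕ) (t : ℝ) :
    radialOp m (regPart m a b j) t = (a * t + b) * regPart m a b j t - t ^ j := by
  have := radialOp_ser_solCoeff (entireBound_pi_single j le_rfl le_rfl)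
    (entireBound_regPart m a b j) t
  rwa [ser_pi_single] at this

theorem continuous_solCoeff (m : ℕ) (a c₀ : ℝ) (e : ℕ → ℝ) (k : ℕ) :
    Continuous fun b => solCoeff m a b c₀ e k := by
  induction k using Nat.strong_induction_on with
  | _ k ih =>
    match k with
    | 0 => simpa [solCoeff] using continuous_const
    | 1 => simp only [solCoeff]; fun_prop
    | k + 2 =>
      have i0 := ih k (by omega)
      have i1 := ih (k + 1) (by omega)
      simp only [solCoeff]; fun_prop

theorem continuous_reg (m : ℕ) (a : ℝ) : Continuous fun p : ℝ × ℝ => reg m a p.1 p.2 :=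
  continuous_ser_param (continuous_solCoeff m a 1 0) fun A =>
    ⟨1, max |a| A + 1, fun _ hb => entireBound_reg (le_max_left _ _) (hb.trans (le_max_right _ _))⟩

theorem continuous_deriv_reg (m : ℕ) (a : ℝ) :
    Continuous fun p : ℝ × ℝ => deriv (reg m a p.1) p.2 := by
  have : (fun p : ℝ × ℝ => deriv (reg m a p.1) p.2) =
      fun p => ser (dcoef (solCoeff m a p.1 1 0)) p.2 := by
    funext p; rw [reg, (entireBound_reg' m a p.1).deriv_ser]
  rw [this]
  exact continuous_ser_param (c := fun b => dcoef (solCoeff m a b 1 0))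
    (fun k => (continuous_solCoeff m a 1 0 (k + 1)).const_mul _) fun A =>
    ⟨1 * (max |a| A + 1), max |a| A + 1, fun _ hb =>
      (entireBound_reg (le_max_left _ _) (hb.trans (le_max_right _ _))).dcoef⟩

theorem continuous_flux_reg (m : ℕ) (a : ℝ) : Continuous fun b => flux m (reg m a b) := by
  have h1 : Continuous fun b : ℝ => reg m a b 1 :=
    (continuous_reg m a).comp (continuous_id.prodMk continuous_const)
  have h2 : Continuous fun b : ℝ => deriv (reg m a b) 1 :=
    (continuous_deriv_reg m a).comp (continuous_id.prodMk continuous_const)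
  simp only [flux]
  fun_prop

theorem solCoeff_nonneg (m : ℕ) {a b : ℝ} (ha : 0 ≤ a) (hb : 0 ≤ b) (k : ℕ) :
    0 ≤ solCoeff m a b 1 0 k := by
  induction k using Nat.strong_induction_on with
  | _ k ih =>
    match k with
    | 0 => simp [solCoeff]
    | 1 => simp only [solCoeff, Pi.zero_apply]; apply div_nonneg _ (by positivity); linarith
    | k + 2 =>
      have i0 := ih k (by omega)
      have i1 := ih (k + 1) (by omega)
      simp only [solCoeff, Pi.zero_apply, sub_zero]; positivity

theorem one_le_reg (m : ℕ) {a b t : ℝ} (ha : 0 ≤ a) (hb : 0 ≤ b) (ht : 0 ≤ t) :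
    1 ≤ reg m a b t := by
  have := ((entireBound_reg' m a b).summable t).le_tsum 0 fun k _ =>
    mul_nonneg (solCoeff_nonneg m ha hb k) (pow_nonneg ht k)
  simpa [solCoeff, reg, ser] using this

theorem deriv_reg_pos (m : ℕ) {a b t : ℝ} (ha : 0 ≤ a) (hb : 0 < b) (ht : 0 ≤ t) :
    0 < deriv (reg m a b) t := by
  rw [reg, (entireBound_reg' m a b).deriv_ser]
  have := ((entireBound_reg' m a b).dcoef.summable t).le_tsum 0 fun k _ =>
    mul_nonneg (mul_nonneg (by positivity) (solCoeff_nonneg m ha hb.le (k + 1))) (pow_nonneg ht k)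
  refine lt_of_lt_of_le ?_ this
  simp [dcoef, solCoeff]
  positivity

/-! ### Wronskian comparison and radial ground states -/

theorem hasDerivAt_of_smooth {F : ℝ → ℝ} (hF : ContDiff ℝ ∞ F) (t : ℝ) :
    HasDerivAt F (deriv F t) t :=
  (hF.differentiable (by simp) t).hasDerivAt

theorem smooth_deriv {F : ℝ → ℝ} (hF : ContDiff ℝ ∞ F) : ContDiff ℝ ∞ (deriv F) :=
  (contDiff_infty_iff_deriv.1 hF).2

/-- The Wronskian `t ^ (m + 1) (F' p - F p')` of two functions, and its derivative in terms of the
radial operator. -/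
theorem hasDerivAt_wronskian (m : ℕ) {F p : ℝ → ℝ} (hF : ContDiff ℝ ∞ F) (hp : ContDiff ℝ ∞ p)
    (t : ℝ) :
    HasDerivAt (fun t => t ^ (m + 1) * (deriv F t * p t - F t * deriv p t))
      (t ^ m / 4 * (radialOp m F t * p t - F t * radialOp m p t)) t := by
  have hF1 := hasDerivAt_of_smooth hF t
  have hF2 := hasDerivAt_of_smooth (smooth_deriv hF) t
  have hp1 := hasDerivAt_of_smooth hp t
  have hp2 := hasDerivAt_of_smooth (smooth_deriv hp) t
  refine ((hasDerivAt_pow (m + 1) t).mul ((hF2.mul hp1).sub (hF1.mul hp2))).congr_deriv ?_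
  simp only [radialOp, Pi.sub_apply, Pi.mul_apply]
  push_cast
  ring

theorem wronskian_le (m : ℕ) {F p : ℝ → ℝ} (hF : ContDiff ℝ ∞ F) (hp : ContDiff ℝ ∞ p)
    (h : ∀ t ∈ Ioo (0 : ℝ) 1, radialOp m F t * p t ≤ F t * radialOp m p t) :
    deriv F 1 * p 1 ≤ F 1 * deriv p 1 := by
  have hd := hasDerivAt_wronskian m hF hp
  have : AntitoneOn (fun t => t ^ (m + 1) * (deriv F t * p t - F t * deriv p t)) (Icc 0 1) := by
    refine antitoneOn_of_deriv_nonpos (convex_Icc 0 1)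
      (fun t _ => (hd t).continuousAt.continuousWithinAt)
      (fun t _ => (hd t).differentiableAt.differentiableWithinAt) fun t ht => ?_
    rw [interior_Icc] at ht
    rw [(hd t).deriv]
    exact mul_nonpos_of_nonneg_of_nonpos (by have := ht.1; positivity) (by linarith [h t ht])
  have := this (left_mem_Icc.2 zero_le_one) (right_mem_Icc.2 zero_le_one) zero_le_one
  simp at this
  linarith

theorem wronskian_lt (m : ℕ) {F p : ℝ → ℝ} (hF : ContDiff ℝ ∞ F) (hp : ContDiff ℝ ∞ p)
    (h : ∀ t ∈ Ioo (0 : ℝ) 1, radialOp m F t * p t < F t * radialOp m p t) :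
    deriv F 1 * p 1 < F 1 * deriv p 1 := by
  have hd := hasDerivAt_wronskian m hF hp
  have : StrictAntiOn (fun t => t ^ (m + 1) * (deriv F t * p t - F t * deriv p t)) (Icc 0 1) := by
    refine strictAntiOn_of_deriv_neg (convex_Icc 0 1)
      (fun t _ => (hd t).continuousAt.continuousWithinAt) fun t ht => ?_
    rw [interior_Icc] at ht
    rw [(hd t).deriv]
    exact mul_neg_of_pos_of_neg (by have := ht.1; positivity) (by linarith [h t ht])
  have := this (left_mem_Icc.2 zero_le_one) (right_mem_Icc.2 zero_le_one) zero_lt_one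
  simp at this
  linarith

/-- Uniqueness for the initial value problem at a point `t₀ > 0`, by a Gronwall estimate for the
energy `F² + F'²` backwards in time. -/
theorem eq_zero_of_radialOp {m : ℕ} {a b t₀ ε : ℝ} {F : ℝ → ℝ} (hF : ContDiff ℝ ∞ F)
    (h : ∀ t, radialOp m F t = (a * t + b) * F t) (hε : 0 < ε) (hεt : ε ≤ t₀) (ht : t₀ ≤ 1)
    (h0 : F t₀ = 0) (h1 : deriv F t₀ = 0) : F ε = 0 := by
  set C : ℝ := 1 + (|a| + |b|) / (4 * ε) + 2 * (m + 1) / ε with hC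
  have hF1 := hasDerivAt_of_smooth hF
  have hF2 := hasDerivAt_of_smooth (smooth_deriv hF)
  set E : ℝ → ℝ := fun t => (F t ^ 2 + deriv F t ^ 2) * Real.exp (C * t) with hE
  have hd : ∀ t, HasDerivAt E ((2 * F t * deriv F t + 2 * deriv F t * deriv (deriv F) t +
      C * (F t ^ 2 + deriv F t ^ 2)) * Real.exp (C * t)) t := fun t => by
    have e := ((hasDerivAt_id t).const_mul C).exp
    refine ((((hF1 t).pow 2).add ((hF2 t).pow 2)).mul e).congr_deriv ?_
    simp
    ring
  have hm : MonotoneOn E (Icc ε t₀) := by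
    refine monotoneOn_of_deriv_nonneg (convex_Icc _ _)
      (fun t _ => (hd t).continuousAt.continuousWithinAt)
      (fun t _ => (hd t).differentiableAt.differentiableWithinAt) fun t hti => ?_
    rw [interior_Icc] at hti
    have ht0 : 0 < t := hε.trans hti.1
    rw [(hd t).deriv]
    refine mul_nonneg ?_ (Real.exp_pos _).le
    have e2 : deriv (deriv F) t = ((a * t + b) / (4 * t)) * F t - (m + 1) / t * deriv F t := by
      have := h t
      rw [radialOp] at this
      field_simp
      linarith
    rw [e2]
    have q1 : |1 + (a * t + b) / (4 * t)| ≤ 1 + (|a| + |b|) / (4 * ε) := by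
      refine (abs_add_le _ _).trans ?_
      rw [abs_one, abs_div, abs_of_pos (by positivity : 0 < 4 * t)]
      gcongr
      · refine (abs_add_le _ _).trans ?_
        rw [abs_mul, abs_of_pos ht0]
        gcongr
        exact mul_le_of_le_one_right (abs_nonneg _) (hti.2.le.trans ht)
      · exact hti.1.le
    have q2 : 2 * ((m : ℝ) + 1) / t ≤ 2 * (m + 1) / ε := by gcongr; exact hti.1.le
    have q3 : |F t * deriv F t| ≤ (F t ^ 2 + deriv F t ^ 2) / 2 := by
      rw [abs_le]; constructor <;> nlinarith [sq_nonneg (F t + deriv F t), sq_nonneg (F t - deriv F t)]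
    have q4 : |(1 + (a * t + b) / (4 * t)) * (F t * deriv F t)| ≤
        (1 + (|a| + |b|) / (4 * ε)) * ((F t ^ 2 + deriv F t ^ 2) / 2) := by
      rw [abs_mul]; gcongr
    have q5 := (abs_le.1 q4).1
    have q6 : 2 * ((m : ℝ) + 1) / t * deriv F t ^ 2 ≤
        2 * (m + 1) / ε * (F t ^ 2 + deriv F t ^ 2) := by
      gcongr
      exact le_add_of_nonneg_left (sq_nonneg _)
    have e3 : 2 * F t * deriv F t + 2 * deriv F t * ((a * t + b) / (4 * t) * F t -
        (m + 1) / t * deriv F t) + C * (F t ^ 2 + deriv F t ^ 2) =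
        2 * ((1 + (a * t + b) / (4 * t)) * (F t * deriv F t)) - 2 * (m + 1) / t * deriv F t ^ 2 +
        C * (F t ^ 2 + deriv F t ^ 2) := by ring
    rw [e3, hC]
    linarith
  have := hm (left_mem_Icc.2 hεt) (right_mem_Icc.2 hεt) hεt
  simp only [hE, h0, h1] at this
  have hp : 0 < Real.exp (C * ε) := Real.exp_pos _
  have h2 : F ε ^ 2 + deriv F ε ^ 2 ≤ 0 := by
    by_contra hcon
    push Not at hcon
    have := mul_pos hcon hp
    simp at *
    linarith
  nlinarith [sq_nonneg (F ε), sq_nonneg (deriv F ε)]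

theorem deriv_reg_ne_zero (m : ℕ) (a b : ℝ) {t₀ : ℝ} (h0 : 0 < t₀) (h1 : t₀ ≤ 1)
    (hz : reg m a b t₀ = 0) : deriv (reg m a b) t₀ ≠ 0 := by
  intro hz'
  have hc : Tendsto (reg m a b) (𝓝[>] 0) (𝓝 1) := by
    have := (contDiff_reg m a b).continuous.tendsto 0
    rw [reg_zero] at this
    exact this.mono_left nhdsWithin_le_nhds
  have : Tendsto (reg m a b) (𝓝[>] 0) (𝓝 0) := by
    refine tendsto_const_nhds.congr' ?_
    filter_upwards [Ioo_mem_nhdsGT h0] with ε hε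
    exact (eq_zero_of_radialOp (contDiff_reg m a b) (radialOp_reg m a b) hε.1 hε.2.le h1 hz hz').symm
  exact one_ne_zero (tendsto_nhds_unique hc this)

/-- Comparison with `1 + m - m t` shows that the flux of a positive solution is not positive
when `b` is very negative. -/
theorem lower_bound_of_pos {m : ℕ} {a b : ℝ} (ha : 0 ≤ a)
    (h : ∀ t ∈ Icc (0 : ℝ) 1, 0 < reg m a b t) (hf : 0 < flux m (reg m a b)) :
    -a - 4 * m * (m + 1) ≤ b := by
  by_contra! hb
  have hm : (0 : ℝ) ≤ m := m.cast_nonneg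
  have hp : ContDiff ℝ ∞ fun t : ℝ => 1 + m - m * t := by fun_prop
  have d1 : ∀ t, deriv (fun t : ℝ => 1 + (m : ℝ) - m * t) t = -m := fun t => by
    simp
  have d2 : deriv (fun t : ℝ => 1 + (m : ℝ) - m * t) = fun _ => -(m : ℝ) := funext d1
  have := wronskian_le m (contDiff_reg m a b) hp fun t ht => by
    have hpos := h t (Ioo_subset_Icc_self ht)
    rw [radialOp_reg]
    simp only [radialOp, d2, deriv_const]
    have h1 : 1 ≤ 1 + m - m * t := by nlinarith [ht.2]
    have h2 : a * t + b ≤ -(4 * m * (m + 1)) := by nlinarith [ht.2]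
    have h3 : (a * t + b) * (1 + m - m * t) ≤ -(4 * m * (m + 1)) * 1 := by
      have : 0 ≤ 4 * (m : ℝ) * (m + 1) := by positivity
      nlinarith
    nlinarith
  simp only [d2] at this
  have h1 := h 1 (right_mem_Icc.2 zero_le_one)
  rw [flux] at hf
  nlinarith [mul_nonneg hm h1.le]

/-- Existence of the ground state of the mode `m`: the largest zero `b` of the flux, with a positive
solution. It is found as the infimum of those `b₀` for which the solution and its flux are positive
for all `b ≥ b₀`. -/
theorem exists_ground (m : ℕ) {a : ℝ} (ha : 0 ≤ a) :
    ∃ b, IsGreatest {b | flux m (reg m a b) = 0} b ∧ ∀ t ∈ Icc (0 : ℝ) 1, 0 < reg m a b t := by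
  set good : ℝ → Prop := fun b => (∀ t ∈ Icc (0 : ℝ) 1, 0 < reg m a b t) ∧ 0 < flux m (reg m a b)
    with hgood
  have hopen : ∀ b, good b → ∀ᶠ b' in 𝓝 b, good b' := by
    intro b hb
    refine Filter.Eventually.and ?_ ((continuous_flux_reg m a).continuousAt.eventually_const_lt hb.2)
    refine isCompact_Icc.eventually_forall_of_forall_eventually fun t ht => ?_
    have hc : ContinuousAt (fun p : ℝ × ℝ => reg m a p.1 p.2) (b, t) :=
      (continuous_reg m a).continuousAt
    exact hc.eventually_const_lt (hb.1 t ht)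
  set S : Set ℝ := {b₀ | ∀ b, b₀ ≤ b → good b} with hS
  have hne : (1 : ℝ) ∈ S := fun b hb => by
    have hb0 : 0 < b := by linarith
    refine ⟨fun t ht => zero_lt_one.trans_le (one_le_reg m ha hb0.le ht.1), ?_⟩
    have h1 := one_le_reg m ha hb0.le (zero_le_one : (0 : ℝ) ≤ 1)
    have h2 := deriv_reg_pos m ha hb0 (zero_le_one : (0 : ℝ) ≤ 1)
    rw [flux]; positivity
  have hbdd : BddBelow S := ⟨-a - 4 * m * (m + 1), fun b hb =>
    lower_bound_of_pos ha (hb b le_rfl).1 (hb b le_rfl).2⟩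
  set B := sInf S with hB
  have hgt : ∀ b, B < b → good b := fun b hb => by
    obtain ⟨b₀, h0, h1⟩ := exists_lt_of_csInf_lt ⟨1, hne⟩ hb
    exact h0 b h1.le
  have hnn : ∀ t ∈ Icc (0 : ℝ) 1, 0 ≤ reg m a B t := fun t ht => by
    have hc : Continuous fun b : ℝ => reg m a b t :=
      (continuous_reg m a).comp (continuous_id.prodMk continuous_const)
    refine ge_of_tendsto (hc.continuousWithinAt (s := Ioi B)) ?_
    filter_upwards [self_mem_nhdsWithin] with b hb using ((hgt b hb).1 t ht).le
  have hfl : 0 ≤ flux m (reg m a B) := by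
    refine ge_of_tendsto ((continuous_flux_reg m a).continuousWithinAt (s := Ioi B)) ?_
    filter_upwards [self_mem_nhdsWithin] with b hb using (hgt b hb).2.le
  have hder := hasDerivAt_of_smooth (contDiff_reg m a B)
  have hpos : ∀ t ∈ Icc (0 : ℝ) 1, 0 < reg m a B t := by
    intro t ht
    refine (hnn t ht).lt_of_ne' fun hz => ?_
    have ht0 : 0 < t := ht.1.lt_of_ne (fun h => by
      rw [← h, reg_zero] at hz; exact one_ne_zero hz)
    refine deriv_reg_ne_zero m a B ht0 ht.2 hz ?_
    rcases ht.2.lt_or_eq with h1 | h1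
    · have : IsLocalMin (reg m a B) t := by
        filter_upwards [Ioo_mem_nhds ht0 h1] with s hs
        rw [hz]; exact hnn s (Ioo_subset_Icc_self hs)
      exact this.deriv_eq_zero
    · subst h1
      refine le_antisymm ?_ (by rw [flux, hz] at hfl; linarith)
      -- difference quotients from the left are nonpositive
      have hl := (hder 1).hasDerivWithinAt (s := Iio 1)
      rw [hasDerivWithinAt_iff_tendsto_slope' (by simp)] at hl
      refine le_of_tendsto hl ?_
      filter_upwards [Ioo_mem_nhdsLT (zero_lt_one : (0 : ℝ) < 1)] with s hs
      rw [slope_def_field, hz]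
      exact div_nonpos_of_nonneg_of_nonpos (by linarith [hnn s (Ioo_subset_Icc_self hs)])
        (by linarith [hs.2])
  have hzero : flux m (reg m a B) = 0 := by
    by_contra hcon
    have hg : good B := ⟨hpos, hfl.lt_of_ne' hcon⟩
    obtain ⟨ε, hε, hball⟩ := Metric.eventually_nhds_iff.1 (hopen B hg)
    have : B - ε / 2 ∈ S := fun b hb => by
      rcases lt_or_ge B b with h | h
      · exact hgt b h
      · exact hball (by rw [Real.dist_eq, abs_lt]; constructor <;> linarith)
    linarith [csInf_le hbdd this]
  refine ⟨B, ⟨hzero, fun b hb => ?_⟩, hpos⟩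
  by_contra! hlt
  exact (hgt b hlt).2.ne' hb

/-- The largest `b` for which the regular solution of `radialOp m F = (a t + b) F` satisfies the
Neumann condition. Up to sign and a shift, it is the lowest energy in the mode `m`. -/
noncomputable def topRoot (m : ℕ) (a : ℝ) : ℝ := sSup {b | flux m (reg m a b) = 0}

theorem isGreatest_topRoot (m : ℕ) {a : ℝ} (ha : 0 ≤ a) :
    IsGreatest {b | flux m (reg m a b) = 0} (topRoot m a) := by
  obtain ⟨b, hb, -⟩ := exists_ground m ha
  rwa [topRoot, hb.csSup_eq]

theorem reg_topRoot_pos (m : ℕ) {a : ℝ} (ha : 0 ≤ a) :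
    ∀ t ∈ Icc (0 : ℝ) 1, 0 < reg m a (topRoot m a) t := by
  obtain ⟨b, hb, h⟩ := exists_ground m ha
  rwa [topRoot, hb.csSup_eq]

/-- The Neumann condition of the ground state. -/
theorem deriv_reg_topRoot (m : ℕ) {a : ℝ} (ha : 0 ≤ a) :
    2 * deriv (reg m a (topRoot m a)) 1 = -m * reg m a (topRoot m a) 1 := by
  have := (isGreatest_topRoot m ha).1
  simp only [mem_ofPred_eq, flux] at this
  linarith

/-- Wronskian comparison of the ground states for two fields; it makes `topRoot m` Lipschitz. -/
theorem topRoot_le_add (m : ℕ) {a a' : ℝ} (ha : 0 ≤ a) (ha' : 0 ≤ a') :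
    topRoot m a ≤ topRoot m a' + |a - a'| := by
  by_contra! hcon
  have := wronskian_lt m (contDiff_reg m a' (topRoot m a')) (contDiff_reg m a (topRoot m a))
    fun t ht => by
      have h1 := reg_topRoot_pos m ha t (Ioo_subset_Icc_self ht)
      have h2 := reg_topRoot_pos m ha' t (Ioo_subset_Icc_self ht)
      rw [radialOp_reg, radialOp_reg]
      have h3 : a' * t + topRoot m a' < a * t + topRoot m a := by
        have : (a' - a) * t ≤ |a - a'| * 1 := by
          rw [abs_sub_comm]
          exact mul_le_mul (le_abs_self _) ht.2.le ht.1.le (abs_nonneg _)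
        linarith
      have := mul_lt_mul_of_pos_right h3 (mul_pos h1 h2)
      linarith
  have h1 := deriv_reg_topRoot m ha
  have h2 := deriv_reg_topRoot m ha'
  have e1 : deriv (reg m a (topRoot m a)) 1 = -m * reg m a (topRoot m a) 1 / 2 := by linarith
  have e2 : deriv (reg m a' (topRoot m a')) 1 = -m * reg m a' (topRoot m a') 1 / 2 := by linarith
  rw [e1, e2] at this
  linarith

theorem continuousOn_topRoot (m : ℕ) : ContinuousOn (topRoot m) (Ici 0) := by
  refine LipschitzOnWith.continuousOn (K := 1) (LipschitzOnWith.of_dist_le_mul fun a ha a' ha' => ?_)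
  rw [Real.dist_eq, Real.dist_eq, NNReal.coe_one, one_mul, abs_le]
  have h1 := topRoot_le_add m ha ha'
  have h2 := topRoot_le_add m ha' ha
  rw [abs_sub_comm] at h2
  constructor <;> linarith

/-- The centrifugal term `m² / r²` is at least `m²` on the unit disk: Wronskian comparison of
`r ^ m F(r²)` with the ground state of the mode `0`, in the variable `r`. -/
theorem topRoot_add_sq_lt {m : ℕ} (hm : 0 < m) {a : ℝ} (ha : 0 ≤ a) :
    topRoot m a + (m : ℝ) ^ 2 < topRoot 0 a := by
  by_contra! hcon
  set F := reg m a (topRoot m a) with hF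
  set φ := reg 0 a (topRoot 0 a) with hφ
  have hF1 := hasDerivAt_of_smooth (contDiff_reg m a (topRoot m a))
  have hF2 := hasDerivAt_of_smooth (smooth_deriv (contDiff_reg m a (topRoot m a)))
  have hp1 := hasDerivAt_of_smooth (contDiff_reg 0 a (topRoot 0 a))
  have hp2 := hasDerivAt_of_smooth (smooth_deriv (contDiff_reg 0 a (topRoot 0 a)))
  rw [← hF] at hF1 hF2
  rw [← hφ] at hp1 hp2
  obtain ⟨k, rfl⟩ : ∃ k, m = k + 1 := ⟨m - 1, by omega⟩
  set w : ℝ → ℝ := fun t =>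
    t * (deriv F t * φ t - F t * deriv φ t) + ((k + 1 : ℕ) : ℝ) / 2 * (F t * φ t) with hw
  have hwd : ∀ t, HasDerivAt w ((deriv F t * φ t - F t * deriv φ t) +
      t * (deriv (deriv F) t * φ t - F t * deriv (deriv φ) t) +
      ((k + 1 : ℕ) : ℝ) / 2 * (deriv F t * φ t + F t * deriv φ t)) t := fun t => by
    refine (((hasDerivAt_id t).mul (((hF2 t).mul (hp1 t)).sub ((hF1 t).mul (hp2 t)))).add
      (((hF1 t).mul (hp1 t)).const_mul (((k + 1 : ℕ) : ℝ) / 2))).congr_deriv ?_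
    simp only [id, Pi.sub_apply, Pi.mul_apply]
    ring
  set W : ℝ → ℝ := fun r => r ^ (k + 1) * w (r ^ 2) with hW
  have hWd : ∀ r, HasDerivAt W (r ^ k / 2 * ((topRoot (k + 1) a - topRoot 0 a) * r ^ 2 +
      ((k + 1 : ℕ) : ℝ) ^ 2) * (F (r ^ 2) * φ (r ^ 2))) r := fun r => by
    refine ((hasDerivAt_pow (k + 1) r).mul ((hwd (r ^ 2)).comp r (hasDerivAt_pow 2 r))).congr_deriv ?_
    have o1 := radialOp_reg (k + 1) a (topRoot (k + 1) a) (r ^ 2)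
    have o2 := radialOp_reg 0 a (topRoot 0 a) (r ^ 2)
    rw [radialOp, ← hF] at o1
    rw [radialOp, ← hφ] at o2
    have o3 : 4 * r ^ 2 * (deriv (deriv F) (r ^ 2) * φ (r ^ 2) - F (r ^ 2) * deriv (deriv φ) (r ^ 2)) =
      (topRoot (k + 1) a - topRoot 0 a) * (F (r ^ 2) * φ (r ^ 2)) -
      4 * (((k + 1 : ℕ) : ℝ) + 1) * deriv F (r ^ 2) * φ (r ^ 2) +
      4 * F (r ^ 2) * deriv φ (r ^ 2) := by
      push_cast at o1 o2 ⊢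
      linear_combination φ (r ^ 2) * o1 - F (r ^ 2) * o2
    simp only [Function.comp, hw]
    rw [Nat.add_sub_cancel]
    push_cast at o3 ⊢
    linear_combination (r ^ (k + 2) / 2) * o3
  have hmono : StrictMonoOn W (Icc 0 1) := by
    refine strictMonoOn_of_deriv_pos (convex_Icc 0 1)
      (fun t _ => (hWd t).continuousAt.continuousWithinAt) fun r hr => ?_
    rw [interior_Icc] at hr
    have hr2 : r ^ 2 ∈ Icc (0 : ℝ) 1 := ⟨sq_nonneg r, by nlinarith [hr.1, hr.2]⟩
    have h1 := reg_topRoot_pos (k + 1) ha _ hr2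
    have h2 := reg_topRoot_pos 0 ha _ hr2
    have hr0 := hr.1
    rw [(hWd r).deriv]
    refine mul_pos (mul_pos (by positivity) ?_) (mul_pos h1 h2)
    have h3 : 0 < ((k + 1 : ℕ) : ℝ) ^ 2 * (1 - r ^ 2) := by
      have : r ^ 2 < 1 := by nlinarith [hr.1, hr.2]
      have : 0 < 1 - r ^ 2 := by linarith
      positivity
    have h4 : -((k + 1 : ℕ) : ℝ) ^ 2 * r ^ 2 ≤ (topRoot (k + 1) a - topRoot 0 a) * r ^ 2 := by
      gcongr; linarith
    linarith
  have := hmono (left_mem_Icc.2 zero_le_one) (right_mem_Icc.2 zero_le_one) zero_lt_one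
  have e1 := deriv_reg_topRoot (k + 1) ha
  have e2 := deriv_reg_topRoot 0 ha
  rw [← hF] at e1
  rw [← hφ] at e2
  simp only [hW, hw] at this
  have e3 : deriv φ 1 = 0 := by simpa using e2
  have e4 : deriv F 1 = -((k + 1 : ℕ) : ℝ) * F 1 / 2 := by linarith
  simp [e3, e4] at this
  linarith

/-! ### Comparison of the modes `0` and `1` in a strong field -/

/-- Comparison with the lowest Landau level `exp (-β r² / 4)`. -/
theorem neg_lt_topRoot_zero {β : ℝ} (hβ : 0 < β) : -β < topRoot 0 (β ^ 2 / 4) := by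
  by_contra! hcon
  have ha : 0 ≤ β ^ 2 / 4 := by positivity
  set p : ℝ → ℝ := fun t => Real.exp (-(β / 4) * t) with hp
  have hpc : ContDiff ℝ ∞ p := by fun_prop
  have d1 : deriv p = fun t => -(β / 4) * p t := funext fun t => by
    have := (((hasDerivAt_id t).const_mul (-(β / 4))).exp).deriv
    simp only [id, mul_one] at this
    rw [hp, this]; ring
  have d2 : deriv (deriv p) = fun t => (β / 4) ^ 2 * p t := by
    rw [d1]; funext t
    rw [deriv_const_mul_field, d1]; ring
  have h1 := reg_topRoot_pos 0 ha
  have := wronskian_le 0 (contDiff_reg 0 (β ^ 2 / 4) (topRoot 0 (β ^ 2 / 4))) hpc fun t ht => by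
    have h2 := h1 t (Ioo_subset_Icc_self ht)
    have h3 : 0 < p t := Real.exp_pos _
    rw [radialOp_reg, radialOp, d2, d1]
    have h4 := mul_le_mul_of_nonneg_right hcon (mul_pos h2 h3).le
    push_cast
    linarith
  have e2 := deriv_reg_topRoot 0 ha
  have e3 : deriv (reg 0 (β ^ 2 / 4) (topRoot 0 (β ^ 2 / 4))) 1 = 0 := by simpa using e2
  rw [e3, d1] at this
  have h2 := h1 1 (right_mem_Icc.2 zero_le_one)
  have h3 : 0 < p 1 := Real.exp_pos _
  nlinarith [mul_pos (mul_pos hβ h3) h2]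

theorem deriv_reg_topRoot_zero_nonpos {a : ℝ} (ha : 0 ≤ a) {s : ℝ} (hs : s ∈ Ioo (0 : ℝ) 1) :
    deriv (reg 0 a (topRoot 0 a)) s ≤ 0 := by
  set f := reg 0 a (topRoot 0 a) with hf
  set b := topRoot 0 a
  by_contra! hcon
  have hf1 := hasDerivAt_of_smooth (contDiff_reg 0 a b)
  have hf2 := hasDerivAt_of_smooth (smooth_deriv (contDiff_reg 0 a b))
  rw [← hf] at hf1 hf2
  have hpos := reg_topRoot_pos 0 ha
  have hd : ∀ t, HasDerivAt (fun t => t * deriv f t) ((a * t + b) * f t / 4) t := fun t => by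
    refine ((hasDerivAt_id t).mul (hf2 t)).congr_deriv ?_
    have := radialOp_reg 0 a b t
    rw [radialOp, ← hf] at this
    simp at this ⊢
    linarith
  have hc : ∀ x y : ℝ, ContinuousOn (fun t => t * deriv f t) (Icc x y) := fun x y t _ =>
    (hd t).continuousAt.continuousWithinAt
  -- `t f'` first decreases from `0`, then increases to `0`
  rcases le_or_gt (a * s + b) 0 with h | h
  · have : AntitoneOn (fun t => t * deriv f t) (Icc 0 s) := by
      refine antitoneOn_of_deriv_nonpos (convex_Icc _ _) (hc 0 s)
        (fun t _ => (hd t).differentiableAt.differentiableWithinAt) fun t ht => ?_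
      rw [interior_Icc] at ht
      rw [(hd t).deriv]
      have h1 := hpos t ⟨ht.1.le, (ht.2.trans hs.2).le⟩
      have h2 : a * t + b ≤ 0 := by nlinarith [ht.2]
      have := mul_nonpos_of_nonpos_of_nonneg h2 h1.le
      linarith
    have := this (left_mem_Icc.2 hs.1.le) (right_mem_Icc.2 hs.1.le) hs.1.le
    have h3 := mul_pos hs.1 hcon
    simp only [zero_mul] at this
    linarith
  · have : MonotoneOn (fun t => t * deriv f t) (Icc s 1) := by
      refine monotoneOn_of_deriv_nonneg (convex_Icc _ _) (hc s 1)
        (fun t _ => (hd t).differentiableAt.differentiableWithinAt) fun t ht => ?_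
      rw [interior_Icc] at ht
      rw [(hd t).deriv]
      have h1 := hpos t ⟨(hs.1.trans ht.1).le, ht.2.le⟩
      have h2 : 0 ≤ a * t + b := by nlinarith [ht.1]
      positivity
    have := this (left_mem_Icc.2 hs.2.le) (right_mem_Icc.2 hs.2.le) hs.2.le
    have h3 := mul_pos hs.1 hcon
    have e2 := deriv_reg_topRoot 0 ha
    have e3 : deriv f 1 = 0 := by simpa [hf] using e2
    simp only [e3] at this
    linarith

/-- In the strong field `β = 6` the mode `1` has lower energy than the mode `0`. If `f` is the
radial ground state, then `(β / 4) f - f'` is a positive solution for the mode `1` with the same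
energy (this is the action of a ladder operator on `f`), and its flux is negative. -/
theorem topRoot_zero_sub_lt_topRoot_one : topRoot 0 9 - 6 < topRoot 1 9 := by
  by_contra! hcon
  have ha : (0 : ℝ) ≤ 9 := by norm_num
  set b := topRoot 0 9 with hb
  set f := reg 0 9 b with hf
  have hfs : ContDiff ℝ ∞ f := contDiff_reg 0 9 b
  have hf1 := hasDerivAt_of_smooth hfs
  have hf2 := hasDerivAt_of_smooth (smooth_deriv hfs)
  have hf3 := hasDerivAt_of_smooth (smooth_deriv (smooth_deriv hfs))
  have ode : ∀ t, 4 * t * deriv (deriv f) t + 4 * deriv f t = (9 * t + b) * f t := fun t => by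
    have := radialOp_reg 0 9 b t
    rw [radialOp, ← hf] at this
    simpa using this
  have ode' : ∀ t, 4 * t * deriv (deriv (deriv f)) t + 8 * deriv (deriv f) t =
      (9 * t + b) * deriv f t + 9 * f t := fun t => by
    have h1 := (((hasDerivAt_id t).const_mul 4).mul (hf3 t)).add ((hf2 t).const_mul 4)
    have h2 := ((((hasDerivAt_id t).const_mul 9).add_const b).mul (hf1 t))
    have h3 := h1.unique (h2.congr_of_eventuallyEq (Eventually.of_forall fun t => by
      simpa using ode t))
    simp at h3
    linarith
  set P : ℝ → ℝ := fun t => 3 / 2 * f t - deriv f t with hP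
  have hPs : ContDiff ℝ ∞ P := (contDiff_const.mul hfs).sub (smooth_deriv hfs)
  have d1 : deriv P = fun t => 3 / 2 * deriv f t - deriv (deriv f) t := funext fun t =>
    (((hf1 t).const_mul _).sub (hf2 t)).deriv
  have d2 : deriv (deriv P) = fun t => 3 / 2 * deriv (deriv f) t - deriv (deriv (deriv f)) t := by
    rw [d1]; exact funext fun t => (((hf2 t).const_mul _).sub (hf3 t)).deriv
  have hfpos := reg_topRoot_pos 0 ha
  have hgpos := reg_topRoot_pos 1 ha
  have := wronskian_le 1 (contDiff_reg 1 9 (topRoot 1 9)) hPs fun t ht => by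
    have o1 := ode t
    have o2 := ode' t
    have e : radialOp 1 P t = (9 * t + b - 6) * P t := by
      rw [radialOp, d2, d1]
      simp only [hP]
      push_cast
      linear_combination (3 / 2) * o1 - o2
    have h1 : 0 ≤ P t := by
      have h2 := hfpos t (Ioo_subset_Icc_self ht)
      have h3 := deriv_reg_topRoot_zero_nonpos ha ht
      simp only [hP, hf, hb]
      linarith
    rw [radialOp_reg, e]
    have h4 := hgpos t (Ioo_subset_Icc_self ht)
    have := mul_le_mul_of_nonneg_right hcon (mul_nonneg h4.le h1)
    linarith
  have e1 : deriv f 1 = 0 := by simpa using deriv_reg_topRoot 0 ha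
  have e2 := deriv_reg_topRoot 1 ha
  have e3 := ode 1
  have e4 : -6 < b := by
    have := neg_lt_topRoot_zero (β := 6) (by norm_num)
    norm_num at this
    exact this
  have h2 := hfpos 1 (right_mem_Icc.2 zero_le_one)
  have h4 := hgpos 1 (right_mem_Icc.2 zero_le_one)
  have e5 : deriv (deriv f) 1 = (9 + b) * f 1 / 4 := by rw [e1] at e3; linarith
  have e6 : deriv (reg 1 9 (topRoot 1 9)) 1 = -reg 1 9 (topRoot 1 9) 1 / 2 := by
    push_cast at e2; linarith
  rw [d1] at this
  simp only [hP, e1, e5, e6] at this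
  have h5 := mul_pos h2 h4
  have h6 : 0 < (b + 6) * (f 1 * reg 1 9 (topRoot 1 9) 1) := mul_pos (by linarith) h5
  linarith

/-! ### The Sturm–Liouville problem for `n = 0` -/

theorem hasDerivAt_comp_sq {F : ℝ → ℝ} (hF : ContDiff ℝ ∞ F) (r : ℝ) :
    HasDerivAt (fun r => F (r ^ 2)) (2 * r * deriv F (r ^ 2)) r := by
  refine ((hasDerivAt_of_smooth hF (r ^ 2)).comp r (hasDerivAt_pow 2 r)).congr_deriv ?_
  simp; ring

theorem hasDerivAt_deriv_comp_sq {F : ℝ → ℝ} (hF : ContDiff ℝ ∞ F) (r : ℝ) :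
    HasDerivAt (fun r => 2 * r * deriv F (r ^ 2))
      (2 * deriv F (r ^ 2) + 4 * r ^ 2 * deriv (deriv F) (r ^ 2)) r := by
  refine (((hasDerivAt_id r).const_mul 2).mul
    (hasDerivAt_comp_sq (smooth_deriv hF) r)).congr_deriv ?_
  simp; ring

theorem isSturmLiouvilleEigenvalue_topRoot (β : ℝ) :
    IsSturmLiouvilleEigenvalue 0 β 1 (-topRoot 0 (β ^ 2 / 4)) := by
  have ha : 0 ≤ β ^ 2 / 4 := by positivity
  set f := reg 0 (β ^ 2 / 4) (topRoot 0 (β ^ 2 / 4)) with hf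
  have hfs : ContDiff ℝ ∞ f := contDiff_reg _ _ _
  have d1 : deriv (fun r => f (r ^ 2)) = fun r => 2 * r * deriv f (r ^ 2) :=
    funext fun r => (hasDerivAt_comp_sq hfs r).deriv
  have hc : Continuous (deriv f) := (smooth_deriv hfs).continuous
  have e1 : deriv f 1 = 0 := by simpa using deriv_reg_topRoot 0 ha
  refine ⟨fun r => f (r ^ 2), ⟨1 / 2, by norm_num, ?_⟩, ?_, ?_, ?_, ?_⟩
  · exact (reg_topRoot_pos 0 ha _ (by norm_num)).ne'
  · exact ((contDiff_infty.1 hfs 2).comp (contDiff_id.pow 2)).contDiffOn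
  · intro r hr
    rw [d1, (hasDerivAt_deriv_comp_sq hfs r).deriv]
    have o := radialOp_reg 0 (β ^ 2 / 4) (topRoot 0 (β ^ 2 / 4)) (r ^ 2)
    rw [radialOp, ← hf] at o
    have hr0 := hr.1.ne'
    simp only [Nat.cast_zero, Int.cast_zero] at o ⊢
    have e : 1 / r * (2 * r * deriv f (r ^ 2)) = 2 * deriv f (r ^ 2) := by field_simp
    rw [e, zero_div]
    linarith
  · rw [d1]
    have : Continuous fun r => r * (2 * r * deriv f (r ^ 2)) := by fun_prop
    have h := this.tendsto 0
    simp only [zero_mul] at h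
    exact h.mono_left nhdsWithin_le_nhds
  · rw [d1]
    have : Continuous fun r => 2 * r * deriv f (r ^ 2) := by fun_prop
    have h := this.tendsto 1
    simp only [one_pow, e1, mul_zero] at h
    exact h.mono_left nhdsWithin_le_nhds

theorem exists_bound_of_deriv_le {v : ℝ → ℝ} {x y C : ℝ} (hxy : x < y)
    (hd : ∀ r ∈ Ioo x y, DifferentiableAt ℝ v r) (h : ∀ r ∈ Ioo x y, |deriv v r| ≤ C) :
    ∃ K, ∀ r ∈ Ioo x y, |v r| ≤ K := by
  set z := (x + y) / 2
  have hz : z ∈ Ioo x y := ⟨by simp only [z]; linarith, by simp only [z]; linarith⟩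
  have hC : 0 ≤ C := (abs_nonneg _).trans (h z hz)
  refine ⟨|v z| + C * (y - x), fun r hr => ?_⟩
  have h1 := (convex_Ioo x y).norm_image_sub_le_of_norm_deriv_le hd h hz hr
  rw [Real.norm_eq_abs, Real.norm_eq_abs] at h1
  have h2 : |r - z| ≤ y - x := by
    rw [abs_le]; constructor <;> linarith [hr.1, hr.2, hz.1, hz.2]
  have h3 := mul_le_mul_of_nonneg_left h2 hC
  have h4 := abs_sub_abs_le_abs_sub (v r) (v z)
  linarith

/-- A solution of the radial equation with `r v' → 0` at the origin is bounded there. The condition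
first gives `|v| ≤ C / r`; then the equation bounds `(r v')'`, hence `v'`. -/
theorem exists_bound_near_zero {v q : ℝ → ℝ} {Q : ℝ}
    (hv : ∀ r ∈ Ioo (0 : ℝ) 1, HasDerivAt v (deriv v r) r)
    (hv' : ∀ r ∈ Ioo (0 : ℝ) 1, HasDerivAt (fun r => r * deriv v r) (r * q r * v r) r)
    (hq : ∀ r ∈ Ioo (0 : ℝ) 1, |q r| ≤ Q) (h0 : Tendsto (fun r => r * deriv v r) (𝓝[>] 0) (𝓝 0)) :
    ∃ δ K, 0 < δ ∧ ∀ r ∈ Ioo (0 : ℝ) δ, |v r| ≤ K := by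
  have h1 : ∀ᶠ r in 𝓝[>] (0 : ℝ), |r * deriv v r| ≤ 1 := by
    filter_upwards [h0.abs.eventually_le_const (by simp : |(0 : ℝ)| < 1)] with r hr using hr
  obtain ⟨ε, hε, hε1⟩ := (mem_nhdsGT_iff_exists_Ioo_subset.1 h1)
  simp only [mem_Ioi] at hε
  set ρ := min ε 1 / 2 with hρ
  have hρ0 : 0 < ρ := by positivity
  have hρε : ρ < ε := by have := min_le_left ε 1; have : 0 < min ε 1 := by positivity
                         linarith
  have hρ1 : ρ < 1 := by have := min_le_right ε 1; linarith
  have hsub : ∀ r, r ∈ Ioc 0 ρ → r ∈ Ioo (0 : ℝ) 1 := fun r hr => ⟨hr.1, hr.2.trans_lt hρ1⟩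
  have hbd : ∀ r ∈ Ioc 0 ρ, |deriv v r| ≤ (r ^ 2)⁻¹ := fun r hr => by
    have h2 : |r * deriv v r| ≤ 1 := hε1 ⟨hr.1, hr.2.trans_lt hρε⟩
    have hr0 := hr.1
    rw [abs_mul, abs_of_pos hr0] at h2
    rw [← one_div, le_div_iff₀ (by positivity)]
    nlinarith [abs_nonneg (deriv v r), (hsub r hr).2]
  -- `|v r| ≤ C / r`
  have hinv : ∀ r ∈ Ioc 0 ρ, HasDerivAt (fun r : ℝ => r⁻¹) (-(r ^ 2)⁻¹) r := fun r hr =>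
    hasDerivAt_inv hr.1.ne'
  have hm1 : MonotoneOn (fun r => v r - r⁻¹) (Ioc 0 ρ) := by
    refine monotoneOn_of_deriv_nonneg (convex_Ioc _ _)
      (fun r hr => ((hv r (hsub r hr)).sub (hinv r hr)).continuousAt.continuousWithinAt)
      (fun r hr => ((hv r (hsub r (interior_subset hr))).sub
        (hinv r (interior_subset hr))).differentiableAt.differentiableWithinAt) fun r hr => ?_
    have hr := interior_subset hr
    rw [((hv r (hsub r hr)).fun_sub (hinv r hr)).deriv]
    have := (abs_le.1 (hbd r hr)).1
    linarith
  have hm2 : AntitoneOn (fun r => v r + r⁻¹) (Ioc 0 ρ) := by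
    refine antitoneOn_of_deriv_nonpos (convex_Ioc _ _)
      (fun r hr => ((hv r (hsub r hr)).add (hinv r hr)).continuousAt.continuousWithinAt)
      (fun r hr => ((hv r (hsub r (interior_subset hr))).add
        (hinv r (interior_subset hr))).differentiableAt.differentiableWithinAt) fun r hr => ?_
    have hr := interior_subset hr
    rw [((hv r (hsub r hr)).fun_add (hinv r hr)).deriv]
    have := (abs_le.1 (hbd r hr)).2
    linarith
  set C := |v ρ| + ρ⁻¹ + 1 with hC
  have hvr : ∀ r ∈ Ioc 0 ρ, |r * v r| ≤ C := fun r hr => by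
    have a1 := hm1 hr (right_mem_Ioc.2 hρ0) hr.2
    have a2 := hm2 hr (right_mem_Ioc.2 hρ0) hr.2
    simp only at a1 a2
    have a3 : |v r| ≤ |v ρ| + ρ⁻¹ + r⁻¹ := by
      have p1 : 0 < ρ⁻¹ := by positivity
      rw [abs_le]
      constructor <;> linarith [le_abs_self (v ρ), neg_abs_le (v ρ)]
    have hr0 := hr.1
    rw [abs_mul, abs_of_pos hr0]
    calc r * |v r| ≤ r * (|v ρ| + ρ⁻¹ + r⁻¹) := by gcongr
      _ = r * (|v ρ| + ρ⁻¹) + 1 := by field_simp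
      _ ≤ 1 * (|v ρ| + ρ⁻¹) + 1 := by gcongr; exact (hsub r hr).2.le
      _ = C := by rw [hC]; ring
  -- `|(r v')'| ≤ Q C`, so `|v'| ≤ Q C`
  have hder : ∀ r ∈ Ioc 0 ρ, |r * q r * v r| ≤ Q * C := fun r hr => by
    have e : r * q r * v r = q r * (r * v r) := by ring
    rw [e, abs_mul]
    exact mul_le_mul (hq r (hsub r hr)) (hvr r hr) (abs_nonneg _)
      ((abs_nonneg _).trans (hq r (hsub r hr)))
  have hv1 : ∀ r ∈ Ioo 0 ρ, |deriv v r| ≤ Q * C := fun r hr => by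
    have key : ∀ s ∈ Ioo 0 r, |r * deriv v r - s * deriv v s| ≤ Q * C * (r - s) := fun s hs => by
      have hss : Icc s r ⊆ Ioc 0 ρ := fun x hx => ⟨hs.1.trans_le hx.1, hx.2.trans hr.2.le⟩
      have h3 := (convex_Icc s r).norm_image_sub_le_of_norm_hasDerivWithin_le
        (f := fun r => r * deriv v r) (f' := fun r => r * q r * v r) (C := Q * C)
        (fun x hx => (hv' x (hsub x (hss hx))).hasDerivWithinAt)
        (fun x hx => hder x (hss hx)) (left_mem_Icc.2 hs.2.le) (right_mem_Icc.2 hs.2.le)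
      simpa [Real.norm_eq_abs, abs_of_pos (sub_pos.2 hs.2)] using h3
    have lim1 : Tendsto (fun s => |r * deriv v r - s * deriv v s|) (𝓝[>] 0)
        (𝓝 |r * deriv v r - 0|) := (tendsto_const_nhds.sub h0).abs
    have lim2 : Tendsto (fun s => Q * C * (r - s)) (𝓝[>] 0) (𝓝 (Q * C * (r - 0))) := by
      have : Continuous fun s : ℝ => Q * C * (r - s) := by fun_prop
      exact (this.tendsto 0).mono_left nhdsWithin_le_nhds
    have := le_of_tendsto_of_tendsto lim1 lim2 (by
      filter_upwards [Ioo_mem_nhdsGT hr.1] with s hs using key s hs)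
    rw [sub_zero, sub_zero, abs_mul, abs_of_pos hr.1] at this
    exact le_of_mul_le_mul_left (by linarith) hr.1
  obtain ⟨K, hK⟩ := exists_bound_of_deriv_le hρ0
    (fun r hr => (hv r (hsub r ⟨hr.1, hr.2.le⟩)).differentiableAt) hv1
  exact ⟨ρ, K, hρ0, hK⟩

/-- A positive solution `φ` with Neumann condition is a ground state, by Picone's identity:
`(r (v' φ - v φ') v / φ)' = (κ₀ - κ) r v² + r φ² ((v / φ)')²`. -/
theorem topRoot_le_of_isSturmLiouvilleEigenvalue {β κ : ℝ}
    (h : IsSturmLiouvilleEigenvalue 0 β 1 κ) : -topRoot 0 (β ^ 2 / 4) ≤ κ := by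
  by_contra! hlt
  obtain ⟨v, ⟨r₀, hr₀, hvr₀⟩, hv2, hode, hv0, hv1⟩ := h
  have ha : 0 ≤ β ^ 2 / 4 := by positivity
  set b := topRoot 0 (β ^ 2 / 4) with hb
  set f := reg 0 (β ^ 2 / 4) b with hf
  have hfs : ContDiff ℝ ∞ f := contDiff_reg _ _ _
  set φ : ℝ → ℝ := fun r => f (r ^ 2) with hφ
  set φ' : ℝ → ℝ := fun r => 2 * r * deriv f (r ^ 2) with hφ'
  have hφd : ∀ r, HasDerivAt φ (φ' r) r := hasDerivAt_comp_sq hfs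
  have hφd2 := hasDerivAt_deriv_comp_sq hfs
  have e1 : deriv f 1 = 0 := by simpa using deriv_reg_topRoot 0 ha
  have hφpos : ∀ r ∈ Icc (0 : ℝ) 1, 0 < φ r := fun r hr =>
    reg_topRoot_pos 0 ha _ ⟨sq_nonneg r, by nlinarith [hr.1, hr.2]⟩
  have hφc : Continuous φ := continuous_iff_continuousAt.2 fun r => (hφd r).continuousAt
  have hφ'c : Continuous φ' := continuous_iff_continuousAt.2 fun r => (hφd2 r).continuousAt
  have hC : ContDiffOn ℝ (1 + 1) v (Ioo 0 1) := by simpa [one_add_one_eq_two] using hv2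
  rw [contDiffOn_succ_iff_deriv_of_isOpen isOpen_Ioo] at hC
  have hvd : ∀ r ∈ Ioo (0 : ℝ) 1, HasDerivAt v (deriv v r) r := fun r hr =>
    ((hC.1 r hr).differentiableAt (isOpen_Ioo.mem_nhds hr)).hasDerivAt
  have hvd2 : ∀ r ∈ Ioo (0 : ℝ) 1, HasDerivAt (deriv v) (deriv (deriv v) r) r := fun r hr =>
    ((hC.2.2.differentiableOn (by simp) r hr).differentiableAt
      (isOpen_Ioo.mem_nhds hr)).hasDerivAt
  have hrv : ∀ r ∈ Ioo (0 : ℝ) 1, HasDerivAt (fun r => r * deriv v r)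
      (r * (β ^ 2 / 4 * r ^ 2 - κ) * v r) r := fun r hr => by
    refine ((hasDerivAt_id r).mul (hvd2 r hr)).congr_deriv ?_
    have o := hode r hr
    have hr0 := hr.1.ne'
    simp only [Int.cast_zero, zero_div, sub_zero] at o
    have o' : deriv v r = r * (-deriv (deriv v) r + (β * r / 2) ^ 2 * v r - κ * v r) := by
      field_simp at o ⊢
      linarith
    simp only [id]
    linear_combination o'
  have hrφ : ∀ r, HasDerivAt (fun r => r * φ' r) (r * (β ^ 2 / 4 * r ^ 2 + b) * φ r) r :=
    fun r => by
    refine ((hasDerivAt_id r).mul (hφd2 r)).congr_deriv ?_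
    have o := radialOp_reg 0 (β ^ 2 / 4) b (r ^ 2)
    rw [radialOp, ← hf] at o
    simp only [id, hφ, Nat.cast_zero] at o ⊢
    linear_combination r * o
  set W : ℝ → ℝ := fun r => r * deriv v r * φ r - r * φ' r * v r with hW
  have hWd : ∀ r ∈ Ioo (0 : ℝ) 1, HasDerivAt W ((-b - κ) * r * v r * φ r) r := fun r hr => by
    refine (((hrv r hr).mul (hφd r)).sub ((hrφ r).mul (hvd r hr))).congr_deriv ?_
    ring
  set H : ℝ → ℝ := fun r => W r * (v r / φ r) with hH
  have hHd : ∀ r ∈ Ioo (0 : ℝ) 1, HasDerivAt H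
      ((-b - κ) * r * v r ^ 2 + W r ^ 2 / (r * φ r ^ 2)) r := fun r hr => by
    have hp := (hφpos r (Ioo_subset_Icc_self hr)).ne'
    have hr0 := hr.1.ne'
    refine ((hWd r hr).mul ((hvd r hr).div (hφd r) hp)).congr_deriv ?_
    simp only [Pi.div_apply]
    have : deriv v r * φ r - v r * φ' r = W r / r := by
      simp only [hW]; field_simp
    rw [this]
    field_simp
  have hHnn : ∀ r ∈ Ioo (0 : ℝ) 1, (-b - κ) * r * v r ^ 2 ≤ deriv H r := fun r hr => by
    rw [(hHd r hr).deriv]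
    have := hr.1
    have : 0 ≤ W r ^ 2 / (r * φ r ^ 2) := by positivity
    linarith
  have hmono : MonotoneOn H (Ioo 0 1) := by
    refine monotoneOn_of_deriv_nonneg (convex_Ioo _ _)
      (fun r hr => (hHd r hr).continuousAt.continuousWithinAt)
      (fun r hr => (hHd r (interior_subset hr)).differentiableAt.differentiableWithinAt)
      fun r hr => ?_
    have hr := interior_subset hr
    refine le_trans ?_ (hHnn r hr)
    have h1 := hr.1
    have h2 : 0 < -b - κ := by linarith
    positivity
  have hlim : ∀ {l : Filter ℝ} {x : ℝ}, x ∈ Icc (0 : ℝ) 1 → l ≤ 𝓝 x → x * φ' x = 0 →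
      Tendsto (fun r => r * deriv v r) l (𝓝 0) → (∃ K, ∀ᶠ r in l, |v r| ≤ K) →
      Tendsto H l (𝓝 0) := by
    intro l x hx hl hx0 hvl ⟨K, hK⟩
    have hK' : IsBoundedUnder (· ≤ ·) l (norm ∘ v) := ⟨K, by simpa using hK⟩
    have t1 : Tendsto φ l (𝓝 (φ x)) := (hφc.tendsto x).mono_left hl
    have t2 : Tendsto (fun r => r * φ' r) l (𝓝 0) := by
      have : Continuous fun r => r * φ' r := by fun_prop
      rw [← hx0]; exact (this.tendsto x).mono_left hl
    have t3 : Tendsto W l (𝓝 0) := by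
      have := (hvl.mul t1).sub (t2.zero_mul_isBoundedUnder_le hK')
      simpa [hW] using this
    have t4 : Tendsto (fun r => W r * v r * (φ r)⁻¹) l (𝓝 (0 * (φ x)⁻¹)) :=
      (t3.zero_mul_isBoundedUnder_le hK').mul (t1.inv₀ (hφpos x hx).ne')
    rw [zero_mul] at t4
    refine t4.congr fun r => ?_
    simp only [hH]; ring
  have hH0 : Tendsto H (𝓝[>] 0) (𝓝 0) := by
    obtain ⟨δ, K, hδ, hK⟩ := exists_bound_near_zero (q := fun r => β ^ 2 / 4 * r ^ 2 - κ)
      (Q := β ^ 2 / 4 + |κ|) hvd hrv (fun r hr => by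
        refine (abs_sub _ _).trans ?_
        rw [abs_of_nonneg (by positivity)]
        have : r ^ 2 ≤ 1 := by nlinarith [hr.1, hr.2]
        gcongr
        nlinarith) hv0
    refine hlim (left_mem_Icc.2 zero_le_one) nhdsWithin_le_nhds (by simp) hv0 ⟨K, ?_⟩
    filter_upwards [Ioo_mem_nhdsGT hδ] with r hr using hK r hr
  have hH1 : Tendsto H (𝓝[<] 1) (𝓝 0) := by
    have h1 : ∀ᶠ r in 𝓝[<] (1 : ℝ), |deriv v r| ≤ 1 := by
      filter_upwards [hv1.abs.eventually_le_const (by simp : |(0 : ℝ)| < 1)] with r hr using hr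
    obtain ⟨ε, hε, hε1⟩ := (mem_nhdsLT_iff_exists_Ioo_subset.1 h1)
    have hε : ε < 1 := hε
    have hm : max ε 0 < 1 := max_lt hε zero_lt_one
    obtain ⟨K, hK⟩ := exists_bound_of_deriv_le (v := v) (C := 1) hm
      (fun r hr => (hvd r ⟨(le_max_right _ _).trans_lt hr.1, hr.2⟩).differentiableAt)
      (fun r hr => hε1 ⟨(le_max_left _ _).trans_lt hr.1, hr.2⟩)
    refine hlim (right_mem_Icc.2 zero_le_one) nhdsWithin_le_nhds (by simp [hφ', e1]) ?_ ⟨K, ?_⟩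
    · have : Tendsto (fun r : ℝ => r) (𝓝[<] 1) (𝓝 1) := nhdsWithin_le_nhds
      simpa using this.mul hv1
    · filter_upwards [Ioo_mem_nhdsLT hm] with r hr using hK r hr
  have hzero : ∀ r ∈ Ioo (0 : ℝ) 1, H r = 0 := fun r hr => by
    refine le_antisymm (ge_of_tendsto hH1 ?_) (le_of_tendsto hH0 ?_)
    · filter_upwards [Ioo_mem_nhdsLT hr.2] with s hs
      exact hmono hr ⟨hr.1.trans hs.1, hs.2⟩ hs.1.le
    · filter_upwards [Ioo_mem_nhdsGT hr.1] with s hs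
      exact hmono ⟨hs.1, hs.2.trans hr.2⟩ hr hs.2.le
  have hd0 : deriv H r₀ = 0 := by
    have : H =ᶠ[𝓝 r₀] fun _ => 0 := by
      filter_upwards [isOpen_Ioo.mem_nhds hr₀] with r hr using hzero r hr
    rw [this.deriv_eq, deriv_const]
  have := hHnn r₀ hr₀
  rw [hd0] at this
  have h2 : 0 < -b - κ := by linarith
  have h3 := hr₀.1
  have : 0 < (-b - κ) * r₀ * v r₀ ^ 2 := by positivity
  linarith

theorem isLeast_sturmLiouvilleEigenvalues (β : ℝ) :
    IsLeast (sturmLiouvilleEigenvalues 0 β 1) (-topRoot 0 (β ^ 2 / 4)) :=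
  ⟨isSturmLiouvilleEigenvalue_topRoot β, fun _ h => topRoot_le_of_isSturmLiouvilleEigenvalue h⟩

/-! ### Green's formula on the unit disk -/

theorem mem_disk_one {p : ℝ × ℝ} : p ∈ disk 1 ↔ p.1 ^ 2 + p.2 ^ 2 < 1 := by simp [disk]

theorem disk_one_subset : disk 1 ⊆ Metric.closedBall (0 : ℝ × ℝ) 1 := fun p hp => by
  rw [mem_disk_one] at hp
  rw [mem_closedBall_zero_iff, Prod.norm_def, Real.norm_eq_abs, Real.norm_eq_abs]
  exact max_le (abs_le_of_sq_le_sq (by nlinarith [sq_nonneg p.2]) zero_le_one)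
    (abs_le_of_sq_le_sq (by nlinarith [sq_nonneg p.1]) zero_le_one)

theorem isOpen_disk_one : IsOpen (disk 1) := by
  have : disk 1 = {p : ℝ × ℝ | p.1 ^ 2 + p.2 ^ 2 < 1} := by ext p; exact mem_disk_one
  rw [this]
  exact isOpen_lt (by fun_prop) (by fun_prop)

theorem measurableSet_disk_one : MeasurableSet (disk 1) := isOpen_disk_one.measurableSet

instance isFiniteMeasure_restrict_disk_one :
    IsFiniteMeasure ((volume : Measure (ℝ × ℝ)).restrict (disk 1)) :=
  isFiniteMeasure_restrict.2 ((measure_mono disk_one_subset).trans_lt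
    (isCompact_closedBall _ _).measure_lt_top).ne

theorem exists_bound_on_disk {f : ℝ × ℝ → ℂ} (hf : Continuous f) :
    ∃ C, 0 ≤ C ∧ ∀ p ∈ disk 1, ‖f p‖ ≤ C := by
  obtain ⟨C, hC⟩ := (isCompact_closedBall (0 : ℝ × ℝ) 1).exists_bound_of_continuousOn hf.continuousOn
  refine ⟨C, (norm_nonneg _).trans (hC 0 (by simp)), fun p hp => hC p (disk_one_subset hp)⟩

theorem memLp_disk_of_continuous {f : ℝ × ℝ → ℂ} (hf : Continuous f) :
    MemLp f 2 (volume.restrict (disk 1)) := by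
  obtain ⟨C, -, hC⟩ := exists_bound_on_disk hf
  exact MemLp.of_bound hf.aestronglyMeasurable C
    ((ae_restrict_iff' measurableSet_disk_one).2 (Eventually.of_forall hC))

theorem integrable_of_memLp_disk {f : ℝ × ℝ → ℂ} (hf : MemLp f 2 (volume.restrict (disk 1))) :
    Integrable f (volume.restrict (disk 1)) := hf.integrable one_le_two

theorem integrable_mul_continuous {f g : ℝ × ℝ → ℂ} (hf : MemLp f 2 (volume.restrict (disk 1)))
    (hg : Continuous g) : Integrable (fun p => f p * g p) (volume.restrict (disk 1)) :=
  hf.integrable_mul (memLp_disk_of_continuous hg)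

theorem fderiv_eq_zero_of_notMem {φ : ℝ × ℝ → ℝ} {Ω : Set (ℝ × ℝ)} (h : tsupport φ ⊆ Ω)
    {p : ℝ × ℝ} (hp : p ∉ Ω) : fderiv ℝ φ p = 0 := by
  by_contra hcon
  exact hp (h (support_fderiv_subset ℝ (by simpa using hcon)))

theorem weak_of_smooth {u : ℝ × ℝ → ℂ} (hu : ContDiff ℝ ∞ u) (e : ℝ × ℝ) {φ : ℝ × ℝ → ℝ}
    (hφ : IsTestFunction (disk 1) φ) :
    ∫ p in disk 1, u p * ((fderiv ℝ φ p e : ℝ) : ℂ) =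
      -∫ p in disk 1, fderiv ℝ u p e * ((φ p : ℝ) : ℂ) := by
  have hz : ∀ p, p ∉ disk 1 → φ p = 0 := fun p hp => by
    by_contra hcon
    exact hp (hφ.support_subset (subset_tsupport _ hcon))
  rw [setIntegral_eq_integral_of_forall_compl_eq_zero (fun p hp => by
      rw [fderiv_eq_zero_of_notMem hφ.support_subset hp]; simp),
    setIntegral_eq_integral_of_forall_compl_eq_zero (fun p hp => by rw [hz p hp]; simp)]
  have hφd : Differentiable ℝ φ := hφ.smooth.differentiable (by simp)
  have hud : Differentiable ℝ u := hu.differentiable (by simp)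
  set g : ℝ × ℝ → ℂ := fun p => (φ p : ℂ) with hg
  have hgd : ∀ p, fderiv ℝ g p e = ((fderiv ℝ φ p e : ℝ) : ℂ) := fun p => by
    have := (Complex.ofRealCLM.hasFDerivAt.comp p (hφd p).hasFDerivAt).fderiv
    have e2 : g = Complex.ofRealCLM ∘ φ := rfl
    rw [e2, this]; rfl
  have hgdiff : Differentiable ℝ g := fun p => (Complex.ofRealCLM.differentiableAt.comp p (hφd p))
  have hgs : HasCompactSupport g := hφ.compact.comp_left (g := fun x : ℝ => (x : ℂ)) (by simp)
  have hgc : Continuous g := hgdiff.continuous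
  have hgd' : Continuous fun p => fderiv ℝ g p e := by
    simp only [hgd]
    have := hφ.smooth.continuous_fderiv (by simp)
    fun_prop
  have hgs' : HasCompactSupport fun p => fderiv ℝ g p e := hgs.fderiv_apply (𝕜 := ℝ) e
  have hud' : Continuous fun p => fderiv ℝ u p e := by
    have := hu.continuous_fderiv (by simp)
    fun_prop
  have key := integral_mul_fderiv_eq_neg_fderiv_mul_of_integrable (μ := (volume : Measure (ℝ × ℝ)))
    (f := u) (g := g) (v := e) ((hud'.mul hgc).integrable_of_hasCompactSupport hgs.mul_left)
    ((hu.continuous.mul hgd').integrable_of_hasCompactSupport hgs'.mul_left)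
    ((hu.continuous.mul hgc).integrable_of_hasCompactSupport hgs.mul_left)
    (fun p _ => hud p) (fun p _ => hgdiff p)
  simpa only [hgd] using key

theorem isSobolevH1_of_smooth {u : ℝ × ℝ → ℂ} (hu : ContDiff ℝ ∞ u) :
    IsSobolevH1 (disk 1) u (fun p => fderiv ℝ u p (1, 0)) (fun p => fderiv ℝ u p (0, 1)) where
  memLp := memLp_disk_of_continuous hu.continuous
  memLp_x := memLp_disk_of_continuous (by
    have := hu.continuous_fderiv (by simp)
    fun_prop)
  memLp_y := memLp_disk_of_continuous (by
    have := hu.continuous_fderiv (by simp)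
    fun_prop)
  weak_x _ hφ := weak_of_smooth hu _ hφ
  weak_y _ hφ := weak_of_smooth hu _ hφ

theorem memLp_conj {f : ℝ × ℝ → ℂ} {μ : Measure (ℝ × ℝ)} (hf : MemLp f 2 μ) :
    MemLp (fun p => conj (f p)) 2 μ :=
  hf.star

theorem IsSobolevH1.conj {Ω : Set (ℝ × ℝ)} {v vx vy : ℝ × ℝ → ℂ} (h : IsSobolevH1 Ω v vx vy) :
    IsSobolevH1 Ω (fun p => conj (v p)) (fun p => conj (vx p)) (fun p => conj (vy p)) where
  memLp := memLp_conj h.memLp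
  memLp_x := memLp_conj h.memLp_x
  memLp_y := memLp_conj h.memLp_y
  weak_x φ hφ := by
    have := congrArg conj (h.weak_x φ hφ)
    rw [map_neg, ← integral_conj, ← integral_conj] at this
    simpa using this
  weak_y φ hφ := by
    have := congrArg conj (h.weak_y φ hφ)
    rw [map_neg, ← integral_conj, ← integral_conj] at this
    simpa using this

/-- The definition of a weak derivative extends to complex-valued test functions. -/
theorem weak_complex {v w : ℝ × ℝ → ℂ} {e : ℝ × ℝ} (hv : MemLp v 2 (volume.restrict (disk 1)))
    (hw : MemLp w 2 (volume.restrict (disk 1)))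
    (h : ∀ φ : ℝ × ℝ → ℝ, IsTestFunction (disk 1) φ →
      ∫ p in disk 1, v p * ((fderiv ℝ φ p e : ℝ) : ℂ) = -∫ p in disk 1, w p * ((φ p : ℝ) : ℂ))
    {Ψ : ℝ × ℝ → ℂ} (hΨ : ContDiff ℝ ∞ Ψ) (hc : HasCompactSupport Ψ) (hs : tsupport Ψ ⊆ disk 1) :
    ∫ p in disk 1, v p * fderiv ℝ Ψ p e = -∫ p in disk 1, w p * Ψ p := by
  have test : ∀ L : ℂ →L[ℝ] ℝ, IsTestFunction (disk 1) (fun p => L (Ψ p)) := fun L =>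
    ⟨L.contDiff.comp hΨ, hc.comp_left (g := L) (by simp),
      (closure_mono (Function.support_comp_subset (g := L) (by simp) Ψ)).trans hs⟩
  have hd : ∀ (L : ℂ →L[ℝ] ℝ) p, fderiv ℝ (fun p => L (Ψ p)) p e = L (fderiv ℝ Ψ p e) :=
    fun L p => by
      have := (L.hasFDerivAt.comp p (hΨ.differentiable (by simp) p).hasFDerivAt).fderiv
      have e2 : (fun p => L (Ψ p)) = L ∘ Ψ := rfl
      rw [e2, this]; rfl
  have h1 := h _ (test Complex.reCLM)
  have h2 := h _ (test Complex.imCLM)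
  simp only [hd] at h1 h2
  simp only [Complex.reCLM_apply, Complex.imCLM_apply] at h1 h2
  have hΨc := hΨ.continuous
  have hΨc' : Continuous fun p => fderiv ℝ Ψ p e := by
    have := hΨ.continuous_fderiv (by simp)
    fun_prop
  have i1 : Integrable (fun p => v p * ((fderiv ℝ Ψ p e).re : ℂ)) (volume.restrict (disk 1)) :=
    integrable_mul_continuous hv (by fun_prop)
  have i2 : Integrable (fun p => v p * ((fderiv ℝ Ψ p e).im : ℂ)) (volume.restrict (disk 1)) :=
    integrable_mul_continuous hv (by fun_prop)
  have i3 : Integrable (fun p => w p * ((Ψ p).re : ℂ)) (volume.restrict (disk 1)) :=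
    integrable_mul_continuous hw (by fun_prop)
  have i4 : Integrable (fun p => w p * ((Ψ p).im : ℂ)) (volume.restrict (disk 1)) :=
    integrable_mul_continuous hw (by fun_prop)
  have e1 : ∫ p in disk 1, v p * fderiv ℝ Ψ p e =
      (∫ p in disk 1, v p * ((fderiv ℝ Ψ p e).re : ℂ)) +
      (∫ p in disk 1, v p * ((fderiv ℝ Ψ p e).im : ℂ)) * Complex.I := by
    rw [← integral_mul_const, ← integral_add i1 (i2.mul_const _)]
    congr 1; funext p
    nth_rewrite 1 [← Complex.re_add_im (fderiv ℝ Ψ p e)]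
    ring
  have e2 : ∫ p in disk 1, w p * Ψ p = (∫ p in disk 1, w p * ((Ψ p).re : ℂ)) +
      (∫ p in disk 1, w p * ((Ψ p).im : ℂ)) * Complex.I := by
    rw [← integral_mul_const, ← integral_add i3 (i4.mul_const _)]
    congr 1; funext p
    nth_rewrite 1 [← Complex.re_add_im (Ψ p)]
    ring
  rw [e1, e2, h1, h2]
  ring

/-- A smooth step, equal to `0` up to `1` and to `1` from `2` on. -/
noncomputable def cutoff (s : ℝ) : ℝ := Real.smoothTransition (s - 1)

theorem contDiff_cutoff : ContDiff ℝ ∞ cutoff :=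
  Real.smoothTransition.contDiff.comp (contDiff_id.sub contDiff_const)

theorem cutoff_eq_zero {s : ℝ} (h : s ≤ 1) : cutoff s = 0 :=
  Real.smoothTransition.zero_of_nonpos (by linarith)

theorem cutoff_eq_one {s : ℝ} (h : 2 ≤ s) : cutoff s = 1 :=
  Real.smoothTransition.one_of_one_le (by linarith)

theorem abs_cutoff_le (s : ℝ) : |cutoff s| ≤ 1 := by
  rw [cutoff, abs_of_nonneg (Real.smoothTransition.nonneg _)]
  exact Real.smoothTransition.le_one _

theorem deriv_cutoff_of_lt {s : ℝ} (h : s < 1) : deriv cutoff s = 0 := by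
  have : cutoff =ᶠ[𝓝 s] fun _ => 0 := by
    filter_upwards [eventually_lt_nhds h] with x hx using cutoff_eq_zero hx.le
  rw [this.deriv_eq, deriv_const]

theorem deriv_cutoff_of_gt {s : ℝ} (h : 2 < s) : deriv cutoff s = 0 := by
  have : cutoff =ᶠ[𝓝 s] fun _ => 1 := by
    filter_upwards [eventually_gt_nhds h] with x hx using cutoff_eq_one hx.le
  rw [this.deriv_eq, deriv_const]

theorem exists_bound_mul_deriv_cutoff : ∃ M, 0 ≤ M ∧ ∀ s, |s * deriv cutoff s| ≤ M := by
  have hc : Continuous fun s => s * deriv cutoff s :=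
    continuous_id.mul (smooth_deriv contDiff_cutoff).continuous
  obtain ⟨M, hM⟩ := (isCompact_Icc (a := (1 : ℝ)) (b := 2)).exists_bound_of_continuousOn
    hc.continuousOn
  have hM0 : 0 ≤ M := (norm_nonneg _).trans (hM 1 (by norm_num))
  refine ⟨M, hM0, fun s => ?_⟩
  rcases lt_or_ge s 1 with h | h
  · simpa [deriv_cutoff_of_lt h] using hM0
  rcases lt_or_ge 2 s with h' | h'
  · simpa [deriv_cutoff_of_gt h'] using hM0
  · exact hM s ⟨h, h'⟩

/-- The divergence theorem on the disk for a smooth vector field whose normal component vanishes on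
the circle, against an arbitrary `H¹` function: no boundary trace is needed, because the radial
component, `O(1 - |p|²)`, compensates the gradient of the cutoff functions. -/
theorem integral_grad_eq_neg_integral_div {X Y v vx vy : ℝ × ℝ → ℂ} {C : ℝ}
    (hX : ContDiff ℝ ∞ X) (hY : ContDiff ℝ ∞ Y) (hv : IsSobolevH1 (disk 1) v vx vy)
    (hC : ∀ p ∈ disk 1, ‖(p.1 : ℂ) * X p + p.2 * Y p‖ ≤ C * (1 - (p.1 ^ 2 + p.2 ^ 2))) :
    ∫ p in disk 1, (vx p * X p + vy p * Y p) =
      -∫ p in disk 1, v p * (fderiv ℝ X p (1, 0) + fderiv ℝ Y p (0, 1)) := by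
  set ρ : ℝ × ℝ → ℝ := fun p => 1 - (p.1 ^ 2 + p.2 ^ 2) with hρ
  have hρs : ContDiff ℝ ∞ ρ := by fun_prop
  have hρd : ∀ p e, fderiv ℝ ρ p e = -(2 * p.1 * e.1 + 2 * p.2 * e.2) := fun p e => by
    have h1 : HasFDerivAt (fun p : ℝ × ℝ => p.1) (ContinuousLinearMap.fst ℝ ℝ ℝ) p := hasFDerivAt_fst
    have h2 : HasFDerivAt (fun p : ℝ × ℝ => p.2) (ContinuousLinearMap.snd ℝ ℝ ℝ) p := hasFDerivAt_snd
    have := (((h1.pow 2).fun_add (h2.pow 2)).const_sub 1).fderiv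
    simp only [hρ]
    rw [this]
    simp
  have hρpos : ∀ p ∈ disk 1, 0 < ρ p := fun p hp => by
    rw [mem_disk_one] at hp; simp only [hρ]; linarith
  set χ : ℕ → ℝ × ℝ → ℂ := fun k p => (cutoff (k * ρ p) : ℝ) with hχ
  have hχs : ∀ k, ContDiff ℝ ∞ (χ k) := fun k =>
    Complex.ofRealCLM.contDiff.comp (contDiff_cutoff.comp (contDiff_const.mul hρs))
  have hχd : ∀ k p e, fderiv ℝ (χ k) p e =
      ((deriv cutoff (k * ρ p) * (k * fderiv ℝ ρ p e) : ℝ) : ℂ) := fun k p e => by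
    have h1 := (hρs.differentiable (by simp) p).hasFDerivAt.const_mul (k : ℝ)
    have h2 := (hasDerivAt_of_smooth contDiff_cutoff (k * ρ p)).comp_hasFDerivAt p h1
    have h3 := (Complex.ofRealCLM.hasFDerivAt.comp p h2).fderiv
    have e2 : χ k = Complex.ofRealCLM ∘ (cutoff ∘ fun p => (k : ℝ) * ρ p) := rfl
    rw [e2, h3]
    simp
  -- the fields `χ k • X` are admissible test functions
  have hsupp : ∀ (k : ℕ) (Z : ℝ × ℝ → ℂ), 0 < k →
      tsupport (fun p => χ k p * Z p) ⊆ {p | 1 ≤ k * ρ p} := fun k Z hk => by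
    refine closure_minimal (fun p hp => ?_) (isClosed_le continuous_const
      (continuous_const.mul hρs.continuous))
    by_contra hcon
    rw [mem_ofPred_eq, not_le] at hcon
    apply hp
    simp [hχ, cutoff_eq_zero hcon.le]
  have hsub : ∀ k : ℕ, 0 < k → {p | 1 ≤ k * ρ p} ⊆ disk 1 := fun k hk p hp => by
    rw [mem_disk_one]
    have hk' : (0 : ℝ) < k := by exact_mod_cast hk
    have hp' : 1 ≤ k * ρ p := hp
    have : 0 < ρ p := by
      by_contra! hcon
      have := mul_nonpos_of_nonneg_of_nonpos hk'.le hcon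
      linarith
    simp only [hρ] at this; linarith
  have hcomp : ∀ (k : ℕ) (Z : ℝ × ℝ → ℂ), 0 < k → HasCompactSupport (fun p => χ k p * Z p) :=
    fun k Z hk => (isCompact_closedBall (0 : ℝ × ℝ) 1).of_isClosed_subset (isClosed_tsupport _)
      (((hsupp k Z hk).trans (hsub k hk)).trans disk_one_subset)
  have hfd : ∀ (k : ℕ) (Z : ℝ × ℝ → ℂ), ContDiff ℝ ∞ Z → ∀ p e,
      fderiv ℝ (fun p => χ k p * Z p) p e = χ k p * fderiv ℝ Z p e + fderiv ℝ (χ k) p e * Z p :=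
    fun k Z hZ p e => by
      rw [fderiv_fun_mul ((hχs k).differentiable (by simp) p) (hZ.differentiable (by simp) p)]
      simp [mul_comm]
  have hXc := hX.continuous
  have hYc := hY.continuous
  have hXc' : Continuous fun p => fderiv ℝ X p (1, 0) := by
    have := hX.continuous_fderiv (by simp)
    fun_prop
  have hYc' : Continuous fun p => fderiv ℝ Y p (0, 1) := by
    have := hY.continuous_fderiv (by simp)
    fun_prop
  set R : ℝ × ℝ → ℂ := fun p => (p.1 : ℂ) * X p + p.2 * Y p with hR
  set Dv : ℝ × ℝ → ℂ := fun p => fderiv ℝ X p (1, 0) + fderiv ℝ Y p (0, 1) with hDv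
  have hk : ∀ k : ℕ, 0 < k →
      ∫ p in disk 1, v p * (χ k p * Dv p - ((2 * k * deriv cutoff (k * ρ p) : ℝ) : ℂ) * R p) =
      -∫ p in disk 1, χ k p * (vx p * X p + vy p * Y p) := fun k hk => by
    have h1 := weak_complex hv.memLp hv.memLp_x hv.weak_x ((hχs k).mul hX) (hcomp k X hk)
      ((hsupp k X hk).trans (hsub k hk))
    have h2 := weak_complex hv.memLp hv.memLp_y hv.weak_y ((hχs k).mul hY) (hcomp k Y hk)
      ((hsupp k Y hk).trans (hsub k hk))
    have c1 : Continuous fun p => fderiv ℝ (fun p => χ k p * X p) p (1, 0) := by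
      have := ((hχs k).mul hX).continuous_fderiv (by simp)
      fun_prop
    have c2 : Continuous fun p => fderiv ℝ (fun p => χ k p * Y p) p (0, 1) := by
      have := ((hχs k).mul hY).continuous_fderiv (by simp)
      fun_prop
    have h3 := integral_add (integrable_mul_continuous hv.memLp c1)
      (integrable_mul_continuous hv.memLp c2)
    have h4 := integral_add (integrable_mul_continuous hv.memLp_x ((hχs k).continuous.mul hXc))
      (integrable_mul_continuous hv.memLp_y ((hχs k).continuous.mul hYc))
    simp only [Pi.mul_apply] at h4
    calc _ = ∫ p in disk 1, (v p * fderiv ℝ (fun p => χ k p * X p) p (1, 0) +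
          v p * fderiv ℝ (fun p => χ k p * Y p) p (0, 1)) := by
          congr 1; funext p
          rw [hfd k X hX, hfd k Y hY, hχd, hχd, hρd, hρd]
          simp only [hR, hDv]
          push_cast
          ring
      _ = -∫ p in disk 1, (vx p * (χ k p * X p) + vy p * (χ k p * Y p)) := by
          rw [h3, h4, h1, h2, neg_add]
      _ = _ := by congr 2; funext p; ring
  obtain ⟨M, hM0, hM⟩ := exists_bound_mul_deriv_cutoff
  obtain ⟨B, hB0, hB⟩ := exists_bound_on_disk (hXc'.add hYc')
  have hC0 : 0 ≤ C := by
    have := (norm_nonneg _).trans (hC 0 (by rw [mem_disk_one]; simp))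
    simpa using this
  have hlarge : ∀ p ∈ disk 1, ∀ᶠ k : ℕ in atTop, 2 < k * ρ p := fun p hp =>
    (tendsto_natCast_atTop_atTop.atTop_mul_const (hρpos p hp)).eventually_gt_atTop 2
  have lim1 : Tendsto (fun k : ℕ => ∫ p in disk 1,
      v p * (χ k p * Dv p - ((2 * k * deriv cutoff (k * ρ p) : ℝ) : ℂ) * R p)) atTop
      (𝓝 (∫ p in disk 1, v p * Dv p)) := by
    refine tendsto_integral_of_dominated_convergence (fun p => ‖v p‖ * (B + 2 * M * C)) ?_ ?_ ?_ ?_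
    · intro k
      have c1 : Continuous (χ k) := (hχs k).continuous
      have c2 : Continuous fun p => deriv cutoff (k * ρ p) :=
        (smooth_deriv contDiff_cutoff).continuous.comp (continuous_const.mul hρs.continuous)
      exact (integrable_mul_continuous hv.memLp (by fun_prop)).aestronglyMeasurable
    · exact (integrable_of_memLp_disk hv.memLp).norm.mul_const _
    · intro k
      refine (ae_restrict_iff' measurableSet_disk_one).2 (Eventually.of_forall fun p hp => ?_)
      rw [norm_mul]
      gcongr
      refine (norm_sub_le _ _).trans ?_
      have h1 : ‖χ k p * Dv p‖ ≤ B := by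
        rw [norm_mul]
        have h2 : ‖χ k p‖ ≤ 1 := by
          simp only [hχ, Complex.norm_real, Real.norm_eq_abs]; exact abs_cutoff_le _
        calc ‖χ k p‖ * ‖Dv p‖ ≤ 1 * B := by gcongr; exact hB p hp
          _ = B := one_mul B
      have h3 : ‖((2 * k * deriv cutoff (k * ρ p) : ℝ) : ℂ) * R p‖ ≤ 2 * M * C := by
        rw [norm_mul, Complex.norm_real, Real.norm_eq_abs]
        calc |2 * k * deriv cutoff (k * ρ p)| * ‖R p‖
            ≤ |2 * k * deriv cutoff (k * ρ p)| * (C * ρ p) := by gcongr; exact hC p hp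
          _ = 2 * C * |k * ρ p * deriv cutoff (k * ρ p)| := by
              rw [abs_mul, abs_mul, abs_mul, abs_mul, abs_two, abs_of_pos (hρpos p hp)]; ring
          _ ≤ 2 * C * M := by gcongr; exact hM _
          _ = 2 * M * C := by ring
      linarith
    · refine (ae_restrict_iff' measurableSet_disk_one).2 (Eventually.of_forall fun p hp => ?_)
      refine tendsto_const_nhds.congr' ?_
      filter_upwards [hlarge p hp] with k hk
      simp [hχ, cutoff_eq_one hk.le, deriv_cutoff_of_gt hk]
  have i1 := (integrable_mul_continuous hv.memLp_x hXc).add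
    (integrable_mul_continuous hv.memLp_y hYc)
  have lim2 : Tendsto (fun k : ℕ => -∫ p in disk 1, χ k p * (vx p * X p + vy p * Y p)) atTop
      (𝓝 (-∫ p in disk 1, (vx p * X p + vy p * Y p))) := by
    refine (tendsto_integral_of_dominated_convergence (fun p => ‖vx p * X p + vy p * Y p‖)
      (fun k => (hχs k).continuous.aestronglyMeasurable.mul i1.aestronglyMeasurable)
      i1.norm (fun k => Eventually.of_forall fun p => ?_) ?_).neg
    · change ‖χ k p * (vx p * X p + vy p * Y p)‖ ≤ _
      rw [norm_mul]
      refine mul_le_of_le_one_left (norm_nonneg _) ?_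
      simp only [hχ, Complex.norm_real, Real.norm_eq_abs]; exact abs_cutoff_le _
    · refine (ae_restrict_iff' measurableSet_disk_one).2 (Eventually.of_forall fun p hp => ?_)
      refine tendsto_const_nhds.congr' ?_
      filter_upwards [hlarge p hp] with k hk
      simp [hχ, cutoff_eq_one hk.le]
  have := tendsto_nhds_unique lim1 (lim2.congr' (by
    filter_upwards [eventually_gt_atTop 0] with k hk0 using (hk k hk0).symm))
  rw [this, neg_neg]

/-! ### The magnetic Laplacian on smooth functions -/

/-- The covariant derivative `∂ₓ u - i u A₁` with `A₁ = -β y / 2`. -/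
noncomputable def covX (β : ℝ) (u : ℝ × ℝ → ℂ) (p : ℝ × ℝ) : ℂ :=
  fderiv ℝ u p (1, 0) - Complex.I * u p * ((-(β * p.2 / 2) : ℝ) : ℂ)

/-- The covariant derivative `∂_y u - i u A₂` with `A₂ = β x / 2`. -/
noncomputable def covY (β : ℝ) (u : ℝ × ℝ → ℂ) (p : ℝ × ℝ) : ℂ :=
  fderiv ℝ u p (0, 1) - Complex.I * u p * ((β * p.1 / 2 : ℝ) : ℂ)

/-- The magnetic Laplacian `-(∇ - i A) · (∇ - i A) u`. -/
noncomputable def magLap (β : ℝ) (u : ℝ × ℝ → ℂ) (p : ℝ × ℝ) : ℂ :=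
  -(fderiv ℝ (covX β u) p (1, 0) + fderiv ℝ (covY β u) p (0, 1)) +
    Complex.I * (((-(β * p.2 / 2) : ℝ) : ℂ) * covX β u p + ((β * p.1 / 2 : ℝ) : ℂ) * covY β u p)

theorem smooth_fderiv_apply {u : ℝ × ℝ → ℂ} (hu : ContDiff ℝ ∞ u) (e : ℝ × ℝ) :
    ContDiff ℝ ∞ fun p => fderiv ℝ u p e :=
  (hu.fderiv_right (m := ∞) (by simp)).clm_apply contDiff_const

theorem contDiff_covX (β : ℝ) {u : ℝ × ℝ → ℂ} (hu : ContDiff ℝ ∞ u) :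
    ContDiff ℝ ∞ (covX β u) := by
  have h1 := smooth_fderiv_apply hu (1, 0)
  have h0 : ContDiff ℝ ∞ fun p : ℝ × ℝ => -(β * p.2 / 2) := by fun_prop
  have h2 : ContDiff ℝ ∞ fun p : ℝ × ℝ => ((-(β * p.2 / 2) : ℝ) : ℂ) := Complex.ofRealCLM.contDiff.comp h0
  exact h1.sub ((contDiff_const.mul hu).mul h2)

theorem contDiff_covY (β : ℝ) {u : ℝ × ℝ → ℂ} (hu : ContDiff ℝ ∞ u) :
    ContDiff ℝ ∞ (covY β u) := by
  have h1 := smooth_fderiv_apply hu (0, 1)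
  have h0 : ContDiff ℝ ∞ fun p : ℝ × ℝ => β * p.1 / 2 := by fun_prop
  have h2 : ContDiff ℝ ∞ fun p : ℝ × ℝ => ((β * p.1 / 2 : ℝ) : ℂ) := Complex.ofRealCLM.contDiff.comp h0
  exact h1.sub ((contDiff_const.mul hu).mul h2)

/-- Green's formula for smooth functions satisfying the Neumann condition. The potential is
tangential to the circle, so that the magnetic and the ordinary Neumann conditions agree. -/
theorem magneticForm_eq_integral_magLap {β C : ℝ} {u v vx vy : ℝ × ℝ → ℂ} (hu : ContDiff ℝ ∞ u)
    (hC : ∀ p ∈ disk 1, ‖(p.1 : ℂ) * fderiv ℝ u p (1, 0) + p.2 * fderiv ℝ u p (0, 1)‖ ≤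
      C * (1 - (p.1 ^ 2 + p.2 ^ 2))) (hv : IsSobolevH1 (disk 1) v vx vy) :
    magneticForm (disk 1) (fun p => β • standardPotential p) u (fun p => fderiv ℝ u p (1, 0))
      (fun p => fderiv ℝ u p (0, 1)) v vx vy = ∫ p in disk 1, magLap β u p * conj (v p) := by
  have hX := contDiff_covX β hu
  have hY := contDiff_covY β hu
  have hXc := hX.continuous
  have hYc := hY.continuous
  have hw := hv.conj
  have div := integral_grad_eq_neg_integral_div hX hY hw (C := C) fun p hp => by
    refine le_of_eq_of_le ?_ (hC p hp)
    simp only [covX, covY]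
    congr 1
    push_cast
    ring
  have hcA : Continuous fun p : ℝ × ℝ => Complex.I * (((-(β * p.2 / 2) : ℝ) : ℂ) * covX β u p +
      ((β * p.1 / 2 : ℝ) : ℂ) * covY β u p) := by fun_prop
  have hcD : Continuous fun p => fderiv ℝ (covX β u) p (1, 0) + fderiv ℝ (covY β u) p (0, 1) :=
    (smooth_fderiv_apply hX _).continuous.add (smooth_fderiv_apply hY _).continuous
  have i1 := (integrable_mul_continuous hw.memLp_x hXc).add
    (integrable_mul_continuous hw.memLp_y hYc)
  have i2 := integrable_mul_continuous hw.memLp hcA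
  have i3 := integrable_mul_continuous hw.memLp hcD
  calc _ = ∫ p in disk 1, ((conj (vx p) * covX β u p + conj (vy p) * covY β u p) +
        conj (v p) * (Complex.I * (((-(β * p.2 / 2) : ℝ) : ℂ) * covX β u p +
        ((β * p.1 / 2 : ℝ) : ℂ) * covY β u p))) := by
        rw [magneticForm]
        congr 1; funext p
        simp only [covX, covY, standardPotential, Prod.smul_fst, Prod.smul_snd, smul_eq_mul,
          map_sub, map_mul, Complex.conj_I, Complex.conj_ofReal]
        push_cast
        ring
    _ = -(∫ p in disk 1, conj (v p) * (fderiv ℝ (covX β u) p (1, 0) +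
          fderiv ℝ (covY β u) p (0, 1))) + ∫ p in disk 1, conj (v p) *
        (Complex.I * (((-(β * p.2 / 2) : ℝ) : ℂ) * covX β u p +
        ((β * p.1 / 2 : ℝ) : ℂ) * covY β u p)) := by
        rw [← div]
        exact integral_add i1 i2
    _ = _ := by
        rw [← integral_neg]
        refine (integral_add i3.neg i2).symm.trans ?_
        congr 1; funext p
        simp only [magLap, Pi.neg_apply]
        ring

theorem conj_magneticForm (Ω : Set (ℝ × ℝ)) (A : ℝ × ℝ → ℝ × ℝ) (u ux uy v vx vy : ℝ × ℝ → ℂ) :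
    conj (magneticForm Ω A u ux uy v vx vy) = magneticForm Ω A v vx vy u ux uy := by
  rw [magneticForm, magneticForm, ← integral_conj]
  congr 1; funext p
  simp only [map_add, map_mul, Complex.conj_conj]
  ring

/-! ### Functions with a single angular mode -/

/-- The function `(x + i σ y) ^ m F(x² + y²)`. For `σ = 1` and `σ = -1` it has angular
momentum `m` and `-m`. -/
noncomputable def mode (σ : ℝ) (m : ℕ) (F : ℝ → ℝ) (p : ℝ × ℝ) : ℂ :=
  ((p.1 : ℂ) + Complex.I * σ * p.2) ^ m * (F (p.1 ^ 2 + p.2 ^ 2) : ℝ)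

theorem contDiff_mode (σ : ℝ) (m : ℕ) {F : ℝ → ℝ} (hF : ContDiff ℝ ∞ F) :
    ContDiff ℝ ∞ (mode σ m F) := by
  have h1 : ContDiff ℝ ∞ fun p : ℝ × ℝ => (p.1 : ℂ) := Complex.ofRealCLM.contDiff.comp contDiff_fst
  have h2 : ContDiff ℝ ∞ fun p : ℝ × ℝ => (p.2 : ℂ) := Complex.ofRealCLM.contDiff.comp contDiff_snd
  have h3 : ContDiff ℝ ∞ fun p : ℝ × ℝ => F (p.1 ^ 2 + p.2 ^ 2) := hF.comp (by fun_prop)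
  have h4 : ContDiff ℝ ∞ fun p : ℝ × ℝ => ((F (p.1 ^ 2 + p.2 ^ 2) : ℝ) : ℂ) :=
    Complex.ofRealCLM.contDiff.comp h3
  exact ((h1.add (contDiff_const.mul h2)).pow m).mul h4

theorem fderiv_fst_eq {u : ℝ × ℝ → ℂ} (hu : ContDiff ℝ ∞ u) {p : ℝ × ℝ} {w : ℂ}
    (h : HasDerivAt (fun s => u (s, p.2)) w p.1) : fderiv ℝ u p (1, 0) = w := by
  have h1 : HasDerivAt (fun s : ℝ => (s, p.2)) ((1 : ℝ), (0 : ℝ)) p.1 :=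
    (hasDerivAt_id p.1).prodMk (hasDerivAt_const p.1 p.2)
  have h2 := (hu.differentiable (by simp) (p.1, p.2)).hasFDerivAt.comp_hasDerivAt p.1 h1
  exact h2.unique h

theorem fderiv_snd_eq {u : ℝ × ℝ → ℂ} (hu : ContDiff ℝ ∞ u) {p : ℝ × ℝ} {w : ℂ}
    (h : HasDerivAt (fun s => u (p.1, s)) w p.2) : fderiv ℝ u p (0, 1) = w := by
  have h1 : HasDerivAt (fun s : ℝ => (p.1, s)) ((0 : ℝ), (1 : ℝ)) p.2 :=
    (hasDerivAt_const p.2 p.1).prodMk (hasDerivAt_id p.2)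
  have h2 := (hu.differentiable (by simp) (p.1, p.2)).hasFDerivAt.comp_hasDerivAt p.2 h1
  exact h2.unique h

section lines

variable (σ : ℝ) (k : ℕ) (x y : ℝ)

theorem hasDerivAt_coord_pow_fst :
    HasDerivAt (fun s : ℝ => ((s : ℂ) + Complex.I * σ * y) ^ k)
      (k * ((x : ℂ) + Complex.I * σ * y) ^ (k - 1)) x := by
  have h : HasDerivAt (fun s : ℝ => (s : ℂ)) 1 x := (hasDerivAt_id x).ofReal_comp
  simpa using (h.add_const (Complex.I * σ * y)).fun_pow k

theorem hasDerivAt_coord_pow_snd :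
    HasDerivAt (fun s : ℝ => ((x : ℂ) + Complex.I * σ * s) ^ k)
      (k * ((x : ℂ) + Complex.I * σ * y) ^ (k - 1) * (Complex.I * σ)) y := by
  have h : HasDerivAt (fun s : ℝ => (s : ℂ)) 1 y := (hasDerivAt_id y).ofReal_comp
  simpa using ((h.const_mul (Complex.I * σ)).const_add (x : ℂ)).fun_pow k

theorem hasDerivAt_radial_fst {F : ℝ → ℝ} (hF : ContDiff ℝ ∞ F) :
    HasDerivAt (fun s : ℝ => ((F (s ^ 2 + y ^ 2) : ℝ) : ℂ))
      (2 * x * (deriv F (x ^ 2 + y ^ 2) : ℝ)) x := by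
  have h1 := (hasDerivAt_pow 2 x).add_const (y ^ 2)
  have h2 := ((hasDerivAt_of_smooth hF (x ^ 2 + y ^ 2)).comp x h1).ofReal_comp
  refine h2.congr_deriv ?_
  push_cast
  ring

theorem hasDerivAt_radial_snd {F : ℝ → ℝ} (hF : ContDiff ℝ ∞ F) :
    HasDerivAt (fun s : ℝ => ((F (x ^ 2 + s ^ 2) : ℝ) : ℂ))
      (2 * y * (deriv F (x ^ 2 + y ^ 2) : ℝ)) y := by
  have h1 := (hasDerivAt_pow 2 y).const_add (x ^ 2)
  have h2 := ((hasDerivAt_of_smooth hF (x ^ 2 + y ^ 2)).comp y h1).ofReal_comp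
  refine h2.congr_deriv ?_
  push_cast
  ring

end lines

theorem fderiv_mode_fst (σ : ℝ) (m : ℕ) {F : ℝ → ℝ} (hF : ContDiff ℝ ∞ F) (p : ℝ × ℝ) :
    fderiv ℝ (mode σ m F) p (1, 0) =
      m * ((p.1 : ℂ) + Complex.I * σ * p.2) ^ (m - 1) * (F (p.1 ^ 2 + p.2 ^ 2) : ℝ) +
      ((p.1 : ℂ) + Complex.I * σ * p.2) ^ m * (2 * p.1 * (deriv F (p.1 ^ 2 + p.2 ^ 2) : ℝ)) :=
  fderiv_fst_eq (contDiff_mode σ m hF)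
    ((hasDerivAt_coord_pow_fst σ m p.1 p.2).mul (hasDerivAt_radial_fst p.1 p.2 hF))

theorem fderiv_mode_snd (σ : ℝ) (m : ℕ) {F : ℝ → ℝ} (hF : ContDiff ℝ ∞ F) (p : ℝ × ℝ) :
    fderiv ℝ (mode σ m F) p (0, 1) =
      m * ((p.1 : ℂ) + Complex.I * σ * p.2) ^ (m - 1) * (Complex.I * σ) *
        (F (p.1 ^ 2 + p.2 ^ 2) : ℝ) +
      ((p.1 : ℂ) + Complex.I * σ * p.2) ^ m * (2 * p.2 * (deriv F (p.1 ^ 2 + p.2 ^ 2) : ℝ)) :=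
  fderiv_snd_eq (contDiff_mode σ m hF)
    ((hasDerivAt_coord_pow_snd σ m p.1 p.2).mul (hasDerivAt_radial_snd p.1 p.2 hF))

theorem mul_pow_pred (z : ℂ) (m : ℕ) : z * (m * z ^ (m - 1)) = m * z ^ m := by
  cases m with
  | zero => simp
  | succ k => rw [Nat.add_sub_cancel, pow_succ]; ring

/-- The radial derivative of a mode, times `r`. -/
theorem euler_mode (σ : ℝ) (m : ℕ) {F : ℝ → ℝ} (hF : ContDiff ℝ ∞ F) (p : ℝ × ℝ) :
    (p.1 : ℂ) * fderiv ℝ (mode σ m F) p (1, 0) + p.2 * fderiv ℝ (mode σ m F) p (0, 1) =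
      ((p.1 : ℂ) + Complex.I * σ * p.2) ^ m * ((m * F (p.1 ^ 2 + p.2 ^ 2) +
        2 * (p.1 ^ 2 + p.2 ^ 2) * deriv F (p.1 ^ 2 + p.2 ^ 2) : ℝ) : ℂ) := by
  rw [fderiv_mode_fst σ m hF, fderiv_mode_snd σ m hF]
  have h := mul_pow_pred ((p.1 : ℂ) + Complex.I * σ * p.2) m
  push_cast
  linear_combination ((F (p.1 ^ 2 + p.2 ^ 2) : ℝ) : ℂ) * h

theorem norm_coord_pow_le {σ : ℝ} (hσ : σ ^ 2 = 1) (m : ℕ) {p : ℝ × ℝ} (hp : p ∈ disk 1) :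
    ‖((p.1 : ℂ) + Complex.I * σ * p.2) ^ m‖ ≤ 1 := by
  rw [norm_pow]
  refine pow_le_one₀ (norm_nonneg _) ?_
  rw [mem_disk_one] at hp
  have : ‖(p.1 : ℂ) + Complex.I * σ * p.2‖ ^ 2 = p.1 ^ 2 + p.2 ^ 2 := by
    rw [← Complex.normSq_eq_norm_sq, Complex.normSq_apply]
    simp
    linear_combination p.2 ^ 2 * hσ
  nlinarith [norm_nonneg ((p.1 : ℂ) + Complex.I * σ * p.2)]

/-- If the flux of `F` vanishes, the mode satisfies the Neumann condition. -/
theorem exists_bound_euler_mode {σ : ℝ} (hσ : σ ^ 2 = 1) (m : ℕ) {F : ℝ → ℝ}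
    (hF : ContDiff ℝ ∞ F) (h0 : flux m F = 0) :
    ∃ C, ∀ p ∈ disk 1, ‖(p.1 : ℂ) * fderiv ℝ (mode σ m F) p (1, 0) +
      p.2 * fderiv ℝ (mode σ m F) p (0, 1)‖ ≤ C * (1 - (p.1 ^ 2 + p.2 ^ 2)) := by
  set g : ℝ → ℝ := fun t => m * F t + 2 * t * deriv F t with hg
  have hF' := smooth_deriv hF
  have hgs : ContDiff ℝ ∞ g := by fun_prop
  obtain ⟨C, hC⟩ := (isCompact_Icc (a := (0 : ℝ)) (b := 1)).exists_bound_of_continuousOn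
    (smooth_deriv hgs).continuous.continuousOn
  refine ⟨C, fun p hp => ?_⟩
  rw [euler_mode σ m hF, norm_mul, Complex.norm_real]
  have ht := mem_disk_one.1 hp
  have h1 := (convex_Icc (0 : ℝ) 1).norm_image_sub_le_of_norm_deriv_le
    (fun t _ => hgs.differentiable (by simp) t) hC (x := 1) (y := p.1 ^ 2 + p.2 ^ 2)
    (right_mem_Icc.2 zero_le_one) ⟨by positivity, ht.le⟩
  have h2 : g 1 = 0 := by rw [flux] at h0; simp only [hg]; linarith
  rw [h2, sub_zero, Real.norm_eq_abs (p.1 ^ 2 + p.2 ^ 2 - 1), abs_sub_comm,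
    abs_of_pos (by linarith)] at h1
  calc _ ≤ 1 * ‖g (p.1 ^ 2 + p.2 ^ 2)‖ :=
        mul_le_mul_of_nonneg_right (norm_coord_pow_le hσ m hp) (norm_nonneg _)
    _ ≤ _ := by rw [one_mul]; exact h1

theorem magLap_mode (β : ℝ) {σ : ℝ} (hσ : σ ^ 2 = 1) (m : ℕ) {F : ℝ → ℝ} (hF : ContDiff ℝ ∞ F)
    (p : ℝ × ℝ) : magLap β (mode σ m F) p = ((p.1 : ℂ) + Complex.I * σ * p.2) ^ m *
      ((-radialOp m F (p.1 ^ 2 + p.2 ^ 2) + (β ^ 2 / 4 * (p.1 ^ 2 + p.2 ^ 2) - β * σ * m) *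
        F (p.1 ^ 2 + p.2 ^ 2) : ℝ) : ℂ) := by
  have hu := contDiff_mode σ m hF
  have hF' := smooth_deriv hF
  have hX : covX β (mode σ m F) = fun p =>
      m * ((p.1 : ℂ) + Complex.I * σ * p.2) ^ (m - 1) * (F (p.1 ^ 2 + p.2 ^ 2) : ℝ) +
      ((p.1 : ℂ) + Complex.I * σ * p.2) ^ m * (2 * p.1 * (deriv F (p.1 ^ 2 + p.2 ^ 2) : ℝ)) -
      Complex.I * (((p.1 : ℂ) + Complex.I * σ * p.2) ^ m * (F (p.1 ^ 2 + p.2 ^ 2) : ℝ)) *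
        ((-(β * p.2 / 2) : ℝ) : ℂ) := by
    funext p; rw [covX, fderiv_mode_fst σ m hF, mode]
  have hY : covY β (mode σ m F) = fun p =>
      m * ((p.1 : ℂ) + Complex.I * σ * p.2) ^ (m - 1) * (Complex.I * σ) *
        (F (p.1 ^ 2 + p.2 ^ 2) : ℝ) +
      ((p.1 : ℂ) + Complex.I * σ * p.2) ^ m * (2 * p.2 * (deriv F (p.1 ^ 2 + p.2 ^ 2) : ℝ)) -
      Complex.I * (((p.1 : ℂ) + Complex.I * σ * p.2) ^ m * (F (p.1 ^ 2 + p.2 ^ 2) : ℝ)) *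
        ((β * p.1 / 2 : ℝ) : ℂ) := by
    funext p; rw [covY, fderiv_mode_snd σ m hF, mode]
  have hXs := contDiff_covX β hu
  have hYs := contDiff_covY β hu
  have idx : HasDerivAt (fun s : ℝ => (s : ℂ)) 1 p.1 := (hasDerivAt_id p.1).ofReal_comp
  have idy : HasDerivAt (fun s : ℝ => (s : ℂ)) 1 p.2 := (hasDerivAt_id p.2).ofReal_comp
  have dX := fderiv_fst_eq hXs (p := p) (by
    rw [hX]
    exact ((((hasDerivAt_coord_pow_fst σ (m - 1) p.1 p.2).const_mul (m : ℂ)).fun_mul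
      (hasDerivAt_radial_fst p.1 p.2 hF)).fun_add ((hasDerivAt_coord_pow_fst σ m p.1 p.2).fun_mul
      ((idx.const_mul 2).fun_mul (hasDerivAt_radial_fst p.1 p.2 hF')))).fun_sub
      ((((hasDerivAt_coord_pow_fst σ m p.1 p.2).fun_mul
      (hasDerivAt_radial_fst p.1 p.2 hF)).const_mul Complex.I).mul_const
      ((-(β * p.2 / 2) : ℝ) : ℂ)))
  have dY := fderiv_snd_eq hYs (p := p) (by
    rw [hY]
    exact (((((hasDerivAt_coord_pow_snd σ (m - 1) p.1 p.2).const_mul (m : ℂ)).mul_const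
      (Complex.I * σ)).fun_mul
      (hasDerivAt_radial_snd p.1 p.2 hF)).fun_add ((hasDerivAt_coord_pow_snd σ m p.1 p.2).fun_mul
      ((idy.const_mul 2).fun_mul (hasDerivAt_radial_snd p.1 p.2 hF')))).fun_sub
      ((((hasDerivAt_coord_pow_snd σ m p.1 p.2).fun_mul
      (hasDerivAt_radial_snd p.1 p.2 hF)).const_mul Complex.I).mul_const
      ((β * p.1 / 2 : ℝ) : ℂ)))
  rw [magLap, dX, dY, hX, hY, radialOp]
  have hz := mul_pow_pred ((p.1 : ℂ) + Complex.I * σ * p.2) m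
  have hσ' : (σ : ℂ) ^ 2 = 1 := by exact_mod_cast congrArg (fun t : ℝ => (t : ℂ)) hσ
  set Z : ℂ := (p.1 : ℂ) + Complex.I * σ * p.2 with hZ
  set Q := Z ^ (m - 1)
  set Q' := Z ^ (m - 1 - 1)
  set P := Z ^ m
  set f := F (p.1 ^ 2 + p.2 ^ 2)
  set f' := deriv F (p.1 ^ 2 + p.2 ^ 2)
  set f'' := deriv (deriv F) (p.1 ^ 2 + p.2 ^ 2)
  have hI : (Complex.I * σ) ^ 2 = -1 := by rw [mul_pow, Complex.I_sq, hσ']; ring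
  have hII : Complex.I ^ 2 = -1 := Complex.I_sq
  -- `(-y, x) · ∇` acts on `z ^ m` as multiplication by `i σ m`
  have hrot : -(p.2 : ℂ) + Complex.I * σ * p.1 = Complex.I * σ * Z := by
    rw [hZ]; linear_combination -(p.2 : ℂ) * hI
  push_cast
  linear_combination (-(m * ((m - 1 : ℕ) : ℂ) * Q' * f)) * hI - 4 * f' * hz +
    (Complex.I * β * f * (m * Q)) * hrot + β * σ * Complex.I ^ 2 * f * hz +
    (β * σ * f * m * P - P * f * β ^ 2 / 4 * (p.1 ^ 2 + p.2 ^ 2)) * hII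

/-! ### Completeness of the monomials `z ^ a z̄ ^ b` -/

/-- The coordinate `x + i y` on the unit square. -/
noncomputable def zCoord : C(Metric.closedBall (0 : ℝ × ℝ) 1, ℂ) :=
  ⟨fun p => (p.1.1 : ℂ) + Complex.I * p.1.2, by fun_prop⟩

theorem separatesPoints_adjoin_zCoord :
    (StarAlgebra.adjoin ℂ {zCoord}).SeparatesPoints := by
  intro p q hpq
  refine ⟨zCoord, ⟨zCoord, StarAlgebra.self_mem_adjoin_singleton ℂ zCoord, rfl⟩, fun h => hpq ?_⟩
  have hre := congrArg Complex.re h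
  have him := congrArg Complex.im h
  simp [zCoord] at hre him
  exact Subtype.ext (Prod.ext hre him)

/-- An `L²` function on the disk that annihilates all polynomials in `z` and `z̄` vanishes, by
the Stone–Weierstrass theorem. -/
theorem ae_eq_zero_of_integral_monomials {w : ℝ × ℝ → ℂ}
    (hw : MemLp w 2 (volume.restrict (disk 1)))
    (h : ∀ a b : ℕ, ∫ p in disk 1, w p * (((p.1 : ℂ) + Complex.I * p.2) ^ a *
      conj ((p.1 : ℂ) + Complex.I * p.2) ^ b) = 0) :
    w =ᵐ[volume.restrict (disk 1)] 0 := by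
  have hwi := integrable_of_memLp_disk hw
  -- every element of the star algebra generated by `z` is the restriction of a function
  -- annihilated by `w`
  have hpoly : ∀ q ∈ StarAlgebra.adjoin ℂ {zCoord}, ∃ P : ℝ × ℝ → ℂ, Continuous P ∧
      (∀ p : Metric.closedBall (0 : ℝ × ℝ) 1, q p = P p) ∧ ∫ p in disk 1, w p * P p = 0 := by
    intro q hq
    have hq' : q ∈ Subalgebra.toSubmodule (Algebra.adjoin ℂ ({zCoord} ∪ star {zCoord})) := by
      rw [Subalgebra.mem_toSubmodule, ← StarAlgebra.adjoin_toSubalgebra]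
      exact hq
    rw [Algebra.adjoin_eq_span] at hq'
    clear hq
    induction hq' using Submodule.span_induction with
    | mem q hq =>
      have : ({zCoord} ∪ star {zCoord} : Set C(Metric.closedBall (0 : ℝ × ℝ) 1, ℂ)) =
          {zCoord, star zCoord} := by rw [Set.star_singleton]; rfl
      rw [this, SetLike.mem_coe, Submonoid.mem_closure_pair] at hq
      obtain ⟨a, b, rfl⟩ := hq
      exact ⟨_, by fun_prop, fun p => by simp [zCoord], h a b⟩
    | zero => exact ⟨0, continuous_zero, by simp, by simp⟩
    | add q₁ q₂ _ _ h₁ h₂ =>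
      obtain ⟨P₁, c₁, e₁, i₁⟩ := h₁
      obtain ⟨P₂, c₂, e₂, i₂⟩ := h₂
      refine ⟨P₁ + P₂, c₁.add c₂, fun p => by simp [e₁, e₂], ?_⟩
      have := integral_add (integrable_mul_continuous hw c₁) (integrable_mul_continuous hw c₂)
      simp only [Pi.add_apply, mul_add]
      rw [this, i₁, i₂, add_zero]
    | smul c q _ hq =>
      obtain ⟨P, c₁, e₁, i₁⟩ := hq
      refine ⟨fun p => c * P p, by fun_prop, fun p => by simp [e₁], ?_⟩
      have : (fun p => w p * (c * P p)) = fun p => c * (w p * P p) := by funext p; ring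
      rw [this, integral_const_mul, i₁, mul_zero]
  have hcont : ∀ g : ℝ × ℝ → ℂ, Continuous g → ∫ p in disk 1, w p * g p = 0 := by
    intro g hg
    set G : C(Metric.closedBall (0 : ℝ × ℝ) 1, ℂ) := ⟨fun p => g p, by fun_prop⟩
    have hG : G ∈ (StarAlgebra.adjoin ℂ {zCoord}).topologicalClosure := by
      rw [ContinuousMap.starSubalgebra_topologicalClosure_eq_top_of_separatesPoints _
        separatesPoints_adjoin_zCoord]
      trivial
    have hbound : ∀ ε > 0, ‖∫ p in disk 1, w p * g p‖ ≤ (∫ p in disk 1, ‖w p‖) * ε := by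
      intro ε hε
      obtain ⟨q, hq, hd⟩ := Metric.mem_closure_iff.1 hG ε hε
      obtain ⟨P, hPc, hPq, hP0⟩ := hpoly q hq
      have e : ∫ p in disk 1, w p * g p = ∫ p in disk 1, w p * (g p - P p) := by
        have := integral_sub (integrable_mul_continuous hw hg) (integrable_mul_continuous hw hPc)
        rw [hP0, sub_zero] at this
        rw [← this]
        congr 1; funext p; ring
      rw [e, ← integral_mul_const]
      refine norm_integral_le_of_norm_le (hwi.norm.mul_const _) ?_
      refine (ae_restrict_iff' measurableSet_disk_one).2 (Eventually.of_forall fun p hp => ?_)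
      rw [norm_mul]
      gcongr
      have h1 := ContinuousMap.dist_apply_le_dist (f := G) (g := q) ⟨p, disk_one_subset hp⟩
      rw [hPq, dist_eq_norm] at h1
      exact h1.trans hd.le
    have hlim : Tendsto (fun ε : ℝ => (∫ p in disk 1, ‖w p‖) * ε) (𝓝[>] 0) (𝓝 0) := by
      have : Continuous fun ε : ℝ => (∫ p in disk 1, ‖w p‖) * ε := by fun_prop
      have := this.tendsto 0
      rw [mul_zero] at this
      exact this.mono_left nhdsWithin_le_nhds
    have := ge_of_tendsto hlim (by
      filter_upwards [self_mem_nhdsWithin] with ε hε using hbound ε hε)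
    exact norm_le_zero_iff.1 this
  refine ae_eq_zero_of_integral_contDiff_smul_eq_zero hwi.locallyIntegrable fun g hg _ => ?_
  have := hcont (fun p => (g p : ℂ)) (by have := hg.continuous; fun_prop)
  rw [← this]
  congr 1; funext p
  rw [Complex.real_smul, mul_comm]

/-! ### The eigenvalues of the magnetic Neumann Laplacian -/

theorem isNeumannEigenvalue_of_flux_eq_zero {β σ b : ℝ} (hσ : σ ^ 2 = 1) {m : ℕ}
    (h : flux m (reg m (β ^ 2 / 4) b) = 0) :
    -(β * σ * m) - b ∈ neumannEigenvalues (disk 1) β := by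
  set F := reg m (β ^ 2 / 4) b with hF
  have hFs : ContDiff ℝ ∞ F := contDiff_reg _ _ _
  have hu := contDiff_mode σ m hFs
  refine ⟨mode σ m F, _, _, isSobolevH1_of_smooth hu, fun h0 => ?_, fun v vx vy hv => ?_⟩
  · -- a continuous function that vanishes almost everywhere vanishes near the origin
    have hz : EqOn (mode σ m F) 0 (disk 1) :=
      Measure.eqOn_open_of_ae_eq h0 isOpen_disk_one hu.continuous.continuousOn
        continuousOn_const
    have hev : ∀ᶠ r in 𝓝[>] (0 : ℝ), F (r ^ 2) = 0 := by
      filter_upwards [Ioo_mem_nhdsGT (zero_lt_one : (0 : ℝ) < 1)] with r hr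
      have := hz (x := (r, 0)) (mem_disk_one.2 (by nlinarith [hr.1, hr.2]))
      simp [mode, hr.1.ne'] at this
      exact this
    have hc : Tendsto (fun r : ℝ => F (r ^ 2)) (𝓝[>] 0) (𝓝 1) := by
      have : Continuous fun r : ℝ => F (r ^ 2) := hFs.continuous.comp (by fun_prop)
      have := this.tendsto 0
      simp only [ne_eq, OfNat.ofNat_ne_zero, not_false_eq_true, zero_pow, hF, reg_zero] at this
      exact this.mono_left nhdsWithin_le_nhds
    have hc0 : Tendsto (fun r : ℝ => F (r ^ 2)) (𝓝[>] 0) (𝓝 0) :=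
      tendsto_const_nhds.congr' (by filter_upwards [hev] with r hr using hr.symm)
    exact one_ne_zero (tendsto_nhds_unique hc hc0)
  · obtain ⟨C, hC⟩ := exists_bound_euler_mode hσ m hFs h
    rw [magneticForm_eq_integral_magLap hu hC hv, ← integral_const_mul]
    congr 1; funext p
    rw [magLap_mode β hσ m hFs, hF, radialOp_reg, mode]
    push_cast
    ring

/-- Conversely, every eigenvalue comes from a mode with vanishing flux. Otherwise the inhomogeneous
radial equations `(H - λ) g = z ^ m |z| ^ (2 j)` and their conjugates have smooth Neumann
solutions, and an eigenfunction is orthogonal to all monomials in `z` and `z̄`. -/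
theorem exists_flux_eq_zero {β lam : ℝ} (h : lam ∈ neumannEigenvalues (disk 1) β) :
    ∃ σ : ℝ, (σ = 1 ∨ σ = -1) ∧ ∃ m : ℕ,
      flux m (reg m (β ^ 2 / 4) (-(β * σ * m) - lam)) = 0 := by
  by_contra! hcon
  obtain ⟨u, ux, uy, hu, hne, heq⟩ := h
  have key : ∀ σ : ℝ, (σ = 1 ∨ σ = -1) → ∀ m j : ℕ, ∫ p in disk 1, conj (u p) *
      (((p.1 : ℂ) + Complex.I * σ * p.2) ^ m * ((p.1 ^ 2 + p.2 ^ 2 : ℝ) : ℂ) ^ j) = 0 := by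
    intro σ hσ m j
    have hσ2 : σ ^ 2 = 1 := by rcases hσ with rfl | rfl <;> norm_num
    have hfl := hcon σ hσ m
    set b := -(β * σ * m) - lam with hb
    set f := reg m (β ^ 2 / 4) b with hf
    set f₁ := regPart m (β ^ 2 / 4) b j with hf₁
    have hfs : ContDiff ℝ ∞ f := contDiff_reg _ _ _
    have hfs₁ : ContDiff ℝ ∞ f₁ := contDiff_regPart _ _ _ _
    set c := -flux m f₁ / flux m f with hc
    set F : ℝ → ℝ := fun t => f₁ t + c * f t with hF
    have hFs : ContDiff ℝ ∞ F := hfs₁.add (contDiff_const.mul hfs)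
    have d1 : deriv F = fun t => deriv f₁ t + c * deriv f t := funext fun t =>
      ((hasDerivAt_of_smooth hfs₁ t).add ((hasDerivAt_of_smooth hfs t).const_mul c)).deriv
    have d2 : deriv (deriv F) = fun t => deriv (deriv f₁) t + c * deriv (deriv f) t := by
      rw [d1]
      exact funext fun t => ((hasDerivAt_of_smooth (smooth_deriv hfs₁) t).add
        ((hasDerivAt_of_smooth (smooth_deriv hfs) t).const_mul c)).deriv
    have hflux : flux m F = 0 := by
      have : flux m F = flux m f₁ + c * flux m f := by
        simp only [flux, d1]; simp only [hF]; ring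
      rw [this, hc]; field_simp; ring
    have hop : ∀ t, radialOp m F t = (β ^ 2 / 4 * t + b) * F t - t ^ j := fun t => by
      have o1 := radialOp_reg m (β ^ 2 / 4) b t
      have o2 := radialOp_regPart m (β ^ 2 / 4) b j t
      rw [← hf, radialOp] at o1
      rw [← hf₁, radialOp] at o2
      rw [radialOp, d2, d1]; simp only [hF]
      linear_combination o2 + c * o1
    have hg := contDiff_mode σ m hFs
    obtain ⟨C, hC⟩ := exists_bound_euler_mode hσ2 m hFs hflux
    have e1 := heq _ _ _ (isSobolevH1_of_smooth hg)
    have e2 := magneticForm_eq_integral_magLap (β := β) hg hC hu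
    rw [← conj_magneticForm, e1, map_mul, Complex.conj_ofReal, ← integral_conj] at e2
    have hmc : Continuous (magLap β (mode σ m F)) := by
      have h1 := (contDiff_mode σ m hFs).continuous
      have hX := contDiff_covX β hg
      have hY := contDiff_covY β hg
      have h2 := (smooth_fderiv_apply hX (1, 0)).continuous
      have h3 := (smooth_fderiv_apply hY (0, 1)).continuous
      have h4 := hX.continuous
      have h5 := hY.continuous
      unfold magLap
      fun_prop
    have i1 := integrable_mul_continuous (memLp_conj hu.memLp) hmc
    have i2 := (integrable_mul_continuous (memLp_conj hu.memLp) hg.continuous).const_mul (lam : ℂ)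
    have e3 : ∫ p in disk 1, (conj (u p) * magLap β (mode σ m F) p -
        (lam : ℂ) * (conj (u p) * mode σ m F p)) = 0 := by
      rw [integral_sub i1 i2, integral_const_mul, sub_eq_zero]
      refine Eq.trans ?_ (e2.symm.trans ?_)
      · congr 1; funext p; ring
      · congr 2; funext p; simp
    rw [← e3]
    congr 1; funext p
    rw [magLap_mode β hσ2 m hFs, hop, mode, hb]
    push_cast
    ring
  refine hne ?_
  have hz := ae_eq_zero_of_integral_monomials (memLp_conj hu.memLp) fun a b => by
    rcases le_total b a with hab | hab
    · obtain ⟨m, rfl⟩ := Nat.exists_eq_add_of_le hab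
      rw [← key 1 (Or.inl rfl) m b]
      congr 1; funext p
      have : ((p.1 ^ 2 + p.2 ^ 2 : ℝ) : ℂ) = ((p.1 : ℂ) + Complex.I * p.2) *
          conj ((p.1 : ℂ) + Complex.I * p.2) := by
        simp only [map_add, map_mul, Complex.conj_ofReal, Complex.conj_I]
        push_cast
        linear_combination (p.2 : ℂ) ^ 2 * Complex.I_sq
      rw [this, mul_pow, pow_add, Complex.ofReal_one, mul_one]
      ring
    · obtain ⟨m, rfl⟩ := Nat.exists_eq_add_of_le hab
      rw [← key (-1) (Or.inr rfl) m a]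
      congr 1; funext p
      have : ((p.1 ^ 2 + p.2 ^ 2 : ℝ) : ℂ) = ((p.1 : ℂ) + Complex.I * p.2) *
          conj ((p.1 : ℂ) + Complex.I * p.2) := by
        simp only [map_add, map_mul, Complex.conj_ofReal, Complex.conj_I]
        push_cast
        linear_combination (p.2 : ℂ) ^ 2 * Complex.I_sq
      have e : (p.1 : ℂ) + Complex.I * ((-1 : ℝ) : ℂ) * p.2 =
          conj ((p.1 : ℂ) + Complex.I * p.2) := by
        simp
      rw [this, e, mul_pow, pow_add]
      ring
  filter_upwards [hz] with p hp
  simpa using hp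

/-! ### The lowest eigenvalue and the threshold -/

/-- The lowest energy of the mode with angular momentum `m ≥ 0` in the field `β ≥ 0`. The mode `-m`
has the lowest energy `β m - topRoot m (β² / 4)`, which is not smaller. -/
noncomputable def modeEnergy (m : ℕ) (β : ℝ) : ℝ := -(β * m) - topRoot m (β ^ 2 / 4)

/-- The centrifugal energy `m²` outweighs the paramagnetic gain `β m` when `β ≤ m`. -/
theorem modeEnergy_zero_le {m : ℕ} {β : ℝ} (h : m = 0 ∨ β ≤ m) :
    modeEnergy 0 β ≤ modeEnergy m β := by
  rcases Nat.eq_zero_or_pos m with rfl | hm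
  · exact le_rfl
  have hβ : β ≤ m := h.resolve_left hm.ne'
  have h1 := topRoot_add_sq_lt hm (a := β ^ 2 / 4) (by positivity)
  have h2 : (0 : ℝ) ≤ m * (m - β) := mul_nonneg m.cast_nonneg (by linarith)
  simp only [modeEnergy, Nat.cast_zero, mul_zero]
  nlinarith

theorem exists_isLeast_neumannEigenvalues {β : ℝ} (hβ : 0 ≤ β) :
    ∃ m₀, IsLeast (neumannEigenvalues (disk 1) β) (modeEnergy m₀ β) ∧
      ∀ m, modeEnergy m₀ β ≤ modeEnergy m β := by
  have ha : 0 ≤ β ^ 2 / 4 := by positivity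
  obtain ⟨m₀, -, hm₀⟩ := (Finset.range (⌈β⌉₊ + 1)).exists_min_image (fun m => modeEnergy m β)
    ⟨0, by simp⟩
  have hmin : ∀ m, modeEnergy m₀ β ≤ modeEnergy m β := fun m => by
    rcases lt_or_ge m (⌈β⌉₊ + 1) with h | h
    · exact hm₀ m (Finset.mem_range.2 h)
    · refine (hm₀ 0 (by simp)).trans (modeEnergy_zero_le (Or.inr ?_))
      exact (Nat.le_ceil β).trans (by exact_mod_cast (Nat.le_succ _).trans h)
  refine ⟨m₀, ⟨?_, fun lam hlam => ?_⟩, hmin⟩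
  · have := isNeumannEigenvalue_of_flux_eq_zero (β := β) (σ := 1) (by norm_num)
      (isGreatest_topRoot m₀ ha).1
    simpa [modeEnergy] using this
  · obtain ⟨σ, hσ, m, hm⟩ := exists_flux_eq_zero hlam
    have h1 := (isGreatest_topRoot m ha).2 hm
    refine (hmin m).trans ?_
    have h2 : β * σ * m ≤ β * m := by
      have : 0 ≤ β * m := by positivity
      rcases hσ with rfl | rfl <;> nlinarith
    rw [modeEnergy]
    linarith

theorem kappaOne_eq (β : ℝ) : kappaOne 0 β 1 = modeEnergy 0 β := by
  rw [kappaOne, (isLeast_sturmLiouvilleEigenvalues β).csInf_eq, modeEnergy]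
  simp

theorem lambdaOne_eq_kappaOne_iff {β : ℝ} (hβ : 0 ≤ β) :
    lambdaOne (disk 1) β = kappaOne 0 β 1 ↔ ∀ m, modeEnergy 0 β ≤ modeEnergy m β := by
  obtain ⟨m₀, h1, h2⟩ := exists_isLeast_neumannEigenvalues hβ
  rw [lambdaOne, h1.csInf_eq, kappaOne_eq]
  exact ⟨fun h m => h ▸ h2 m, fun h => le_antisymm (h2 0) (h m₀)⟩

theorem lambdaOne_eq_kappaOne_of_le_one {β : ℝ} (hβ : β ∈ Icc (0 : ℝ) 1) :
    lambdaOne (disk 1) β = kappaOne 0 β 1 := by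
  refine (lambdaOne_eq_kappaOne_iff hβ.1).2 fun m => modeEnergy_zero_le ?_
  rcases Nat.eq_zero_or_pos m with rfl | hm
  · exact Or.inl rfl
  · exact Or.inr (hβ.2.trans (by exact_mod_cast hm))

theorem one_mem_radialThresholds : (1 : ℝ) ∈ radialThresholds :=
  ⟨zero_lt_one, fun _ hβ => lambdaOne_eq_kappaOne_of_le_one hβ⟩

theorem bddAbove_radialThresholds : BddAbove radialThresholds := by
  refine ⟨6, fun β₀ h => ?_⟩
  by_contra! hlt
  have h6 : (0 : ℝ) ≤ 6 := by norm_num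
  have := (lambdaOne_eq_kappaOne_iff h6).1 (h.2 6 ⟨h6, hlt.le⟩) 1
  have h9 : (6 : ℝ) ^ 2 / 4 = 9 := by norm_num
  simp only [modeEnergy, h9] at this
  have h1 := topRoot_zero_sub_lt_topRoot_one
  push_cast at this
  linarith

theorem continuous_modeEnergy (m : ℕ) : Continuous (modeEnergy m) := by
  have h : Continuous fun β : ℝ => topRoot m (β ^ 2 / 4) :=
    (continuousOn_topRoot m).comp_continuous (by fun_prop) fun β => by
      simp only [mem_Ici]; positivity
  unfold modeEnergy
  fun_prop

theorem isGreatest_radialThresholds : IsGreatest radialThresholds betaStar := by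
  have h1 : 1 ≤ betaStar := le_csSup bddAbove_radialThresholds one_mem_radialThresholds
  have hlt : ∀ β, 0 ≤ β → β < betaStar → ∀ m, modeEnergy 0 β ≤ modeEnergy m β :=
    fun β h0 hβ => by
      obtain ⟨β₀, hmem, hβ₀⟩ := exists_lt_of_lt_csSup ⟨1, one_mem_radialThresholds⟩ hβ
      exact (lambdaOne_eq_kappaOne_iff h0).1 (hmem.2 β ⟨h0, hβ₀.le⟩)
  refine ⟨⟨by linarith, fun β hβ => (lambdaOne_eq_kappaOne_iff hβ.1).2 fun m => ?_⟩,
    fun β hβ => le_csSup bddAbove_radialThresholds hβ⟩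
  rcases hβ.2.lt_or_eq with h | rfl
  · exact hlt β hβ.1 h m
  · refine le_of_tendsto_of_tendsto
      ((continuous_modeEnergy 0).continuousWithinAt (s := Iio betaStar))
      ((continuous_modeEnergy m).continuousWithinAt (s := Iio betaStar)) ?_
    filter_upwards [Ioo_mem_nhdsLT (show 0 < betaStar by linarith)] with β hβ
    exact hlt β hβ.1.le hβ.2 m

end MagneticDisk

/-- The first conjunct says that `λ₁ᴺ(B₁, β)` and `κ₁(0, β, 1)` really are first eigenvalues, so that
the equalities in the others never compare default values of `sInf`. -/
theorem proposition1p1 :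
    (∀ β : ℝ, 0 ≤ β →
      IsLeast (MagneticDisk.neumannEigenvalues (MagneticDisk.disk 1) β)
        (MagneticDisk.lambdaOne (MagneticDisk.disk 1) β) ∧
      IsLeast (MagneticDisk.sturmLiouvilleEigenvalues 0 β 1) (MagneticDisk.kappaOne 0 β 1)) ∧
    (∀ β ∈ Set.Icc (0 : ℝ) 1,
      MagneticDisk.lambdaOne (MagneticDisk.disk 1) β = MagneticDisk.kappaOne 0 β 1) ∧
    IsGreatest MagneticDisk.radialThresholds MagneticDisk.betaStar ∧
    1 ≤ MagneticDisk.betaStar := by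
  refine ⟨fun β hβ => ⟨?_, ?_⟩, fun β hβ => MagneticDisk.lambdaOne_eq_kappaOne_of_le_one hβ,
    MagneticDisk.isGreatest_radialThresholds,
    MagneticDisk.isGreatest_radialThresholds.2 MagneticDisk.one_mem_radialThresholds⟩
  · obtain ⟨m₀, h, -⟩ := MagneticDisk.exists_isLeast_neumannEigenvalues hβ
    rwa [MagneticDisk.lambdaOne, h.csInf_eq]
  · have h := MagneticDisk.isLeast_sturmLiouvilleEigenvalues β
    rwa [MagneticDisk.kappaOne, h.csInf_eq]
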